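/- **Theorem (Sums of geometrically linked ideals).** Let $K$ be a field, let $R = K[x_0,\dots,x_n]$, and let $\mathfrak m = (x_0,\dots,x_n)$. A closed subscheme $V \subset \mathbb{P}^n = \mathbb{P}^n_K$ is given by its saturated homogeneous ideal $I_V \subset R$; its codimension is the height of $I_V$, and its irreducible components correspond to the minimal primes of $I_V$. For a homogeneous ideal $I \subset R$, the ring $R/I$ is *Cohen–Macaulay* if $\operatorname{depth} R/I = \dim R/I$ (Krull dimension; depth with respect to $\mathfrak m$). If $R/I$ is Cohen–Macaulay and $I$ has codimension (height) $c$, its *Cohen–Macaulay type* is the rank of the last module $F_c$ in the minimal graded free resolution $0 \to F_c \to \cdots \to F_1 \to R \to R/I \to 0$. The ideal $I$ is *Gorenstein* if $R/I$ is Cohen–Macaulay of type $1$. The subscheme $V$ is *arithmetically Cohen–Macaulay* (resp. *arithmetically Gorenstein*) if $R/I_V$ is Cohen–Macaulay (resp. $I_V$ is Gorenstein). Let $V_1, V_2 \subset \mathbb{P}^n$ be arithmetically Cohen–Macaulay subschemes, both of codimension $c$, with no common component. Assume that $X = V_1 \cup V_2$, i.e. the subscheme with $I_X = I_{V_1} \cap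 I_{V_2}$, is arithmetically Gorenstein. Then $I_{V_1} + I_{V_2}$ is a Gorenstein ideal of codimension $c+1$. In particular, if $c < n$, then $I_{V_1} + I_{V_2}$ is the saturated ideal of the scheme-theoretic intersection $V_1 \cap V_2$, and $V_1 \cap V_2$ is arithmetically Gorenstein. (If $c = n$, then $V_1 \cap V_2$ is empty and $R/(I_{V_1}+I_{V_2})$ is an Artinian Gorenstein ring.) -/

import Mathlib

open MvPolynomial

namespace Liaison

/-- The homogeneous coordinate ring `R = K[x₀, …, xₙ]` of `ℙⁿ`. -/
abbrev CoordRing (K : Type*) [Field K] (n : ℕ) : Type _ := MvPolynomial (Fin (n + 1)) K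

attribute [local instance] MvPolynomial.gradedAlgebra

section Saturation

variable {K : Type*} [Field K] {n : ℕ}

/-- An ideal of `R = K[x₀, …, xₙ]` is homogeneous for the standard grading. -/
def IsHomogeneousIdeal (I : Ideal (CoordRing K n)) : Prop :=
  I.IsHomogeneous (homogeneousSubmodule (Fin (n + 1)) K)

/-- The saturation `I^sat = ⋃ₖ (I : 𝔪ᵏ)` with respect to the irrelevant ideal
`𝔪 = (x₀, …, xₙ)`. -/
def saturation (I : Ideal (CoordRing K n)) : Ideal (CoordRing K n) where
  carrier := {f | ∃ k : ℕ, ∀ g ∈ idealOfVars (Fin (n + 1)) K ^ k, g * f ∈ I}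
  zero_mem' := ⟨0, fun g _ => by simp⟩
  add_mem' := by
    rintro a b ⟨k, hk⟩ ⟨l, hl⟩
    refine ⟨max k l, fun g hg => ?_⟩
    rw [mul_add]
    exact I.add_mem (hk g (Ideal.pow_le_pow_right (le_max_left k l) hg))
      (hl g (Ideal.pow_le_pow_right (le_max_right k l) hg))
  smul_mem' := by
    rintro r a ⟨k, hk⟩
    refine ⟨k, fun g hg => ?_⟩
    rw [smul_eq_mul, mul_left_comm]
    exact I.mul_mem_left r (hk g hg)

lemma mem_saturation {I : Ideal (CoordRing K n)} {f : CoordRing K n} :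
    f ∈ saturation I ↔ ∃ k : ℕ, ∀ g ∈ idealOfVars (Fin (n + 1)) K ^ k, g * f ∈ I :=
  Iff.rfl

lemma le_saturation (I : Ideal (CoordRing K n)) : I ≤ saturation I :=
  fun _ hf => ⟨0, fun g _ => I.mul_mem_left g hf⟩

lemma saturation_mono {I J : Ideal (CoordRing K n)} (h : I ≤ J) :
    saturation I ≤ saturation J :=
  fun _ ⟨k, hk⟩ => ⟨k, fun g hg => h (hk g hg)⟩

lemma saturation_saturation (I : Ideal (CoordRing K n)) :
    saturation (saturation I) = saturation I := by
  refine le_antisymm ?_ (le_saturation _)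
  rintro f ⟨k, hk⟩
  obtain ⟨s, hs⟩ := IsNoetherian.noetherian (idealOfVars (Fin (n + 1)) K ^ k)
  have hmem : ∀ g ∈ s, g * f ∈ saturation I := fun g hg =>
    hk g (hs ▸ Submodule.subset_span hg)
  choose! N hN using fun g hg => mem_saturation.1 (hmem g hg)
  refine ⟨s.sup N + k, fun g hg => ?_⟩
  rw [pow_add] at hg
  refine Submodule.mul_induction_on hg (fun a ha b hb => ?_) (fun x y hx hy => ?_)
  · rw [← hs] at hb
    refine Submodule.span_induction (fun x hx => ?_) ?_ (fun x y _ _ hx hy => ?_)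
      (fun r x _ hx => ?_) hb
    · rw [mul_assoc]
      exact hN x hx a (Ideal.pow_le_pow_right (Finset.le_sup hx) ha)
    · simp
    · rw [mul_add, add_mul]
      exact I.add_mem hx hy
    · have : a * r • x * f = r * (a * x * f) := by
        rw [smul_eq_mul]
        ring
      rw [this]
      exact I.mul_mem_left r hx
  · rw [add_mul]
    exact I.add_mem hx hy

lemma IsHomogeneousIdeal.saturation {I : Ideal (CoordRing K n)} (hI : IsHomogeneousIdeal I) :
    IsHomogeneousIdeal (saturation I) := by
  rintro i f ⟨k, hk⟩
  change (DirectSum.decompose (homogeneousSubmodule (Fin (n + 1)) K) f i : CoordRing K n) ∈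
    Liaison.saturation I
  refine ⟨k, fun g hg => ?_⟩
  rw [pow_idealOfVars_eq_span] at hg
  refine Submodule.span_induction ?_ ?_ (fun x y _ _ hx hy => ?_) (fun r x _ hx => ?_) hg
  · rintro _ ⟨x, hx, rfl⟩
    have hx' : x.degree = k := hx
    have h1 : monomial x (1 : K) * f ∈ I := hk _
      ((monomial_mem_pow_idealOfVars_iff k x one_ne_zero).2 hx'.ge)
    have h2 := hI (k + i) h1
    have h3 : monomial x (1 : K) ∈ homogeneousSubmodule (Fin (n + 1)) K k :=
      isHomogeneous_monomial 1 hx'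
    rwa [DirectSum.coe_decompose_mul_add_of_left_mem _ h3] at h2
  · simp
  · rw [add_mul]
    exact I.add_mem hx hy
  · rw [smul_eq_mul, mul_assoc]
    exact I.mul_mem_left r hx

end Saturation

section CohenMacaulay

variable {K : Type*} [Field K] {n : ℕ}

/-- `depth R/I`: the supremum of the lengths of the `R/I`-regular sequences in the irrelevant
ideal `𝔪`. -/
noncomputable def quotientDepth (I : Ideal (CoordRing K n)) : ℕ∞ :=
  sSup {N : ℕ∞ | ∃ rs : List (CoordRing K n), (∀ r ∈ rs, r ∈ idealOfVars (Fin (n + 1)) K) ∧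
    RingTheory.Sequence.IsRegular (CoordRing K n ⧸ I) rs ∧ (rs.length : ℕ∞) = N}

/-- `R/I` is Cohen-Macaulay: `depth R/I = dim R/I`, where `dim` is the Krull dimension. -/
def IsCohenMacaulayQuotient (I : Ideal (CoordRing K n)) : Prop :=
  ((quotientDepth I : ℕ∞) : WithBot ℕ∞) = ringKrullDim (CoordRing K n ⧸ I)

/-- A minimal graded free resolution
`⋯ ⟶ F₂ ⟶ F₁ ⟶ F₀ = R ⟶ R/I ⟶ 0`
of `R/I`, for `I` a proper homogeneous ideal, written in homogeneous bases:
`Fᵢ = ⨁ₖ R(-shift i k)`, where `k` runs over `Fin (rank i)`, and the differential `Fᵢ₊₁ ⟶ Fᵢ`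
is multiplication by the matrix `d i`. The modules `Fᵢ` may be zero. -/
structure MinimalFreeResolution (I : Ideal (CoordRing K n)) where
  /-- the rank of `Fᵢ` -/
  rank : ℕ → ℕ
  /-- the degrees of the basis elements of `Fᵢ` -/
  shift : (i : ℕ) → Fin (rank i) → ℤ
  /-- the matrix of `Fᵢ₊₁ ⟶ Fᵢ` -/
  d : (i : ℕ) → Matrix (Fin (rank i)) (Fin (rank (i + 1))) (CoordRing K n)
  rank_zero : rank 0 = 1
  shift_zero : ∀ k, shift 0 k = 0
  /-- the differentials are graded of degree zero: the entry of `d i` at `(k, l)` is zero or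
  homogeneous of degree `shift (i + 1) l - shift i k` -/
  graded : ∀ i k l, ∀ m ∈ (d i k l).support, shift i k + (m.degree : ℤ) = shift (i + 1) l
  /-- exactness at `F₀ = R`: the image of `F₁ ⟶ R` is `I` -/
  exact_zero : ∀ f : CoordRing K n,
    (fun _ => f) ∈ LinearMap.range (d 0).mulVecLin ↔ f ∈ I
  /-- exactness at `Fᵢ₊₁` -/
  exact_succ : ∀ i, Function.Exact (d (i + 1)).mulVecLin (d i).mulVecLin
  /-- minimality: all entries of the differentials lie in the irrelevant ideal `𝔪` -/
  minimal : ∀ i k l, d i k l ∈ idealOfVars (Fin (n + 1)) K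

/-- `R/I` has Cohen-Macaulay type `r`: with `c` the codimension of `I`, the minimal free
resolution of `R/I` has the form `0 ⟶ F_c ⟶ ⋯ ⟶ F₁ ⟶ R ⟶ R/I ⟶ 0`, and `F_c` has rank `r`. -/
def HasCohenMacaulayType (I : Ideal (CoordRing K n)) (r : ℕ) : Prop :=
  ∃ (F : MinimalFreeResolution I) (c : ℕ),
    I.height = c ∧ (∀ i, c < i → F.rank i = 0) ∧ F.rank c = r

/-- The ideal `I` is Gorenstein: it is homogeneous, and `R/I` is Cohen-Macaulay of
Cohen-Macaulay type `1`. -/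
def IsGorensteinIdeal (I : Ideal (CoordRing K n)) : Prop :=
  IsHomogeneousIdeal I ∧ IsCohenMacaulayQuotient I ∧ HasCohenMacaulayType I 1

end CohenMacaulay

/-- A closed subscheme `V` of `ℙⁿ`, given by its saturated homogeneous ideal `I_V ⊆ R`. (The
empty subscheme has ideal `R`.) -/
structure ProjSubscheme (K : Type*) [Field K] (n : ℕ) where
  /-- the saturated homogeneous ideal `I_V` -/
  ideal : Ideal (CoordRing K n)
  isHomogeneous : IsHomogeneousIdeal ideal
  saturation_eq : saturation ideal = ideal

namespace ProjSubscheme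

variable {K : Type*} [Field K] {n : ℕ}

/-- The union of two subschemes: `I_{V ∪ W} = I_V ∩ I_W`. -/
noncomputable def union (V W : ProjSubscheme K n) : ProjSubscheme K n where
  ideal := V.ideal ⊓ W.ideal
  isHomogeneous := Ideal.IsHomogeneous.inf V.isHomogeneous W.isHomogeneous
  saturation_eq := le_antisymm
    (le_inf ((saturation_mono inf_le_left).trans V.saturation_eq.le)
      ((saturation_mono inf_le_right).trans W.saturation_eq.le))
    (le_saturation _)

/-- The scheme-theoretic intersection of two subschemes: `I_{V ∩ W} = (I_V + I_W)^sat`. -/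
noncomputable def inter (V W : ProjSubscheme K n) : ProjSubscheme K n where
  ideal := saturation (V.ideal ⊔ W.ideal)
  isHomogeneous := IsHomogeneousIdeal.saturation
    (Ideal.IsHomogeneous.sup V.isHomogeneous W.isHomogeneous)
  saturation_eq := saturation_saturation _

/-- `V` has codimension `c` in `ℙⁿ`, that is, `I_V` has height `c`. (The empty subscheme has no
codimension.) -/
def HasCodim (V : ProjSubscheme K n) (c : ℕ) : Prop :=
  V.ideal.height = c

/-- The irreducible components of `V`, as the set of their homogeneous prime ideals: the minimal
primes of `I_V`. -/
def components (V : ProjSubscheme K n) : Set (Ideal (CoordRing K n)) :=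
  V.ideal.minimalPrimes

/-- `V` and `W` have no common component. -/
def NoCommonComponent (V W : ProjSubscheme K n) : Prop :=
  Disjoint V.components W.components

/-- `V` is arithmetically Cohen-Macaulay: its homogeneous coordinate ring `R/I_V` is
Cohen-Macaulay. -/
def IsACM (V : ProjSubscheme K n) : Prop :=
  IsCohenMacaulayQuotient V.ideal

/-- `V` is arithmetically Gorenstein: it is arithmetically Cohen-Macaulay of Cohen-Macaulay
type `1`. -/
def IsArithmeticallyGorenstein (V : ProjSubscheme K n) : Prop :=
  V.IsACM ∧ HasCohenMacaulayType V.ideal 1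

end ProjSubscheme

end Liaison

/-! Write `k = R/𝔪`, and `I`, `J` for the two ideals of height `c`. Everything is read off from the
groups `Ext^i(R/I, k)`. Tensored or mapped into `k`, a minimal resolution has zero differentials, so
the rank of `F_i` is the dimension of `Ext^i(R/I, k)` (`MinimalFreeResolution.nonempty_ext_equiv`).

Cohen–Macaulayness also becomes a vanishing statement. A regular sequence of length `d` on `R/I`
pushes `Ext^i` into degree `i + d`, and all Ext groups vanish above degree `n + 1` by Hilbert's
syzygy theorem. Conversely, vanishing in high degrees produces regular elements, since `Ext^(n+1)(k,
k)` is nonzero. With `dim R/I + height I = n + 1`, this shows that for `I` proper, homogeneous and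
of height `c`, `R/I` is Cohen–Macaulay exactly when `Ext^i(R/I, k) = 0` for all `i > c`.

Now apply `Ext(-, k)` to the Mayer–Vietoris sequence `0 → R/(I ∩ J) → R/I × R/J → R/(I + J) → 0`.
The groups of the middle term vanish above `c`. Hence those of `R/(I + J)` vanish above `c + 1`, and
`Ext^c(R/(I ∩ J), k)`, which is one-dimensional, maps onto `Ext^(c+1)(R/(I + J), k)`. Having no
common minimal prime gives `I + J` height at least `c + 1`, so the vanishing makes `R/(I + J)`
Cohen–Macaulay of codimension exactly `c + 1` and type at most one. Type zero is impossible: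
vanishing already above `c` would force the height to be `c`. If `c < n`, the depth is positive, and
a regular element in `𝔪` makes `I + J` saturated. -/

namespace Liaison

/-! ### The dimension formula for quotients of polynomial rings -/

section Dimension

/-- Induction on the number of variables: polynomial rings over a field are Jacobson, so a maximal
ideal contracts to a maximal ideal in one variable fewer, and the height drops by exactly one. -/
theorem height_eq_of_isMaximal {L : Type*} [Field L] (k : ℕ)
    (M : Ideal (MvPolynomial (Fin k) L)) [hM : M.IsMaximal] : M.height = k := by
  induction k with
  | zero =>
    have hd := MvPolynomial.ringKrullDim_of_isNoetherianRing (R := L) (ι := Fin 0)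
    have h := Ideal.height_le_ringKrullDim_of_ne_top hM.ne_top
    rw [hd] at h
    simp only [ringKrullDim_eq_zero_of_field, Nat.card_eq_fintype_card, Fintype.card_fin,
      Nat.cast_zero, add_zero] at h
    simpa using h
  | succ k ih =>
    let e := (finSuccEquiv L k).toRingEquiv
    have h1 : (M.map e).IsMaximal := Ideal.map_isMaximal_of_equiv e
    obtain ⟨N, hN⟩ : ∃ N : Ideal (Polynomial (MvPolynomial (Fin k) L)), N = M.map e := ⟨_, rfl⟩
    rw [← hN] at h1
    have h2 : (N.under (MvPolynomial (Fin k) L)).IsMaximal :=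
      Polynomial.isMaximal_comap_C_of_isJacobsonRing N
    rw [← e.height_map M, ← hN, Polynomial.height_eq_height_add_one
      (N.under (MvPolynomial (Fin k) L)) N, ih]
    simp

theorem ringKrullDim_le_of_injective_of_isIntegral {A B : Type*} [CommRing A] [CommRing B]
    (g : A →+* B) (hg : Function.Injective g) (hi : g.IsIntegral) :
    ringKrullDim A ≤ ringKrullDim B := by
  algebraize [g]
  have : Algebra.IsIntegral A B := ⟨hi⟩
  have : FaithfulSMul A B := (faithfulSMul_iff_algebraMap_injective A B).2 hg
  refine iSup_le fun l => ?_
  obtain ⟨P, hP, hl⟩ := (Ideal.nonempty_primesOver (S := B) l.head.asIdeal)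
  obtain ⟨L, hL, -⟩ := Ideal.exists_ltSeries_of_hasGoingUp l P
  rw [← hL]
  exact le_iSup (fun p : LTSeries (PrimeSpectrum B) => (p.length : WithBot ℕ∞)) L

variable {K : Type*} [Field K]

/-- Inverting the nonzero elements of `A = K[z₁, …, z_s]` preserves the height of the kernel. Over
the fraction field `F` the image lies in an algebraic extension of `F`, hence is a field, so the
localized kernel is maximal and has height `m`. -/
theorem le_height_ker_of_isIntegral {s m : ℕ} {D : Type*} [CommRing D] [IsDomain D]
    (g : MvPolynomial (Fin s) K →+* D) (hg : Function.Injective g) (hi : g.IsIntegral)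
    (y : Fin m → D) : (m : ℕ∞) ≤ (RingHom.ker (eval₂Hom g y)).height := by
  let A := MvPolynomial (Fin s) K
  let L := FractionRing D
  let F := FractionRing A
  let _ : Algebra A D := g.toAlgebra
  have : Algebra.IsIntegral A D := ⟨hi⟩
  have hAD : Function.Injective (algebraMap A D) := hg
  have hAL : Function.Injective (algebraMap A L) := by
    rw [IsScalarTower.algebraMap_eq A D L]
    exact (IsFractionRing.injective D L).comp hAD
  have : FaithfulSMul A L := (faithfulSMul_iff_algebraMap_injective A L).2 hAL
  let _ : Algebra F L := FractionRing.liftAlgebra A L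
  have : IsScalarTower A F L := inferInstance
  have : Algebra.IsAlgebraic F L := isAlgebraic_of_isFractionRing A D F L
  let ψ : MvPolynomial (Fin m) F →ₐ[F] L := aeval fun i => algebraMap D L (y i)
  have hmax : (RingHom.ker ψ).IsMaximal := by
    have hf : IsField ψ.range := Subalgebra.isField_of_algebraic ψ.range
    have e : (MvPolynomial (Fin m) F ⧸ RingHom.ker ψ) ≃ₐ[F] ψ.range :=
      Ideal.quotientKerEquivRange ψ
    exact Ideal.Quotient.maximal_of_isField _ (e.toMulEquiv.isField hf)
  have h1 := height_eq_of_isMaximal m (RingHom.ker ψ)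
  let _ : Algebra (MvPolynomial (Fin m) A) (MvPolynomial (Fin m) F) := algebraMvPolynomial
  have hloc : IsLocalization ((nonZeroDivisors A).map (C (σ := Fin m))) (MvPolynomial (Fin m) F) :=
    MvPolynomial.isLocalization (nonZeroDivisors A) F
  have h2 := IsLocalization.height_under ((nonZeroDivisors A).map (C (σ := Fin m)))
    (A := MvPolynomial (Fin m) F) (RingHom.ker ψ)
  have h3 : (RingHom.ker ψ).under (MvPolynomial (Fin m) A) = RingHom.ker (eval₂Hom g y) := by
    have hc : (ψ : MvPolynomial (Fin m) F →+* L).comp (algebraMap (MvPolynomial (Fin m) A) _) =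
        (algebraMap D L).comp (eval₂Hom g y) := by
      refine MvPolynomial.ringHom_ext (fun a => ?_) fun i => ?_
      · change ψ (MvPolynomial.map (algebraMap A F) (C a)) = _
        simp only [map_C, RingHom.comp_apply, eval₂Hom_C]
        rw [← MvPolynomial.algebraMap_eq, AlgHom.commutes, ← IsScalarTower.algebraMap_apply]
        rfl
      · change ψ (MvPolynomial.map (algebraMap A F) (X i)) = _
        simp [ψ]
    ext b
    have := congr($hc b)
    simp only [RingHom.comp_apply] at this
    rw [Ideal.mem_comap, RingHom.mem_ker, RingHom.mem_ker]
    change ψ _ = _ at this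
    rw [this, map_eq_zero_iff _ (IsFractionRing.injective D L)]
  rw [← h3, h2, h1]

/-- Let `K[z₁, …, z_s] → R/P` be a Noether normalization, with `R` the polynomial ring in `m`
variables. The induced map `φ` from `K[z][x]` to `R/P` has kernel of height at least `m`. That
kernel is generated by `P` and the `s` elements `zᵢ - lᵢ`, where `lᵢ` lifts the image of `zᵢ`, so
its height is at most `height P + s`; and `s ≤ dim R/P`. -/
theorem le_ringKrullDim_quotient_add_height_of_isPrime {m : ℕ}
    (P : Ideal (MvPolynomial (Fin m) K)) [hP : P.IsPrime] :
    (m : WithBot ℕ∞) ≤ ringKrullDim (MvPolynomial (Fin m) K ⧸ P) + P.height := by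
  obtain ⟨s, -, g, hg, hi⟩ := exists_integral_inj_algHom_of_quotient P hP.ne_top
  have hs : (s : WithBot ℕ∞) ≤ ringKrullDim (MvPolynomial (Fin m) K ⧸ P) := by
    have := ringKrullDim_le_of_injective_of_isIntegral g.toRingHom hg hi
    simpa [MvPolynomial.ringKrullDim_of_isNoetherianRing, ringKrullDim_eq_zero_of_field] using this
  let φ : MvPolynomial (Fin m) (MvPolynomial (Fin s) K) →+*
      (MvPolynomial (Fin m) K) ⧸ P := eval₂Hom g.toRingHom fun i => Ideal.Quotient.mk P (X i)
  have h1 : (m : ℕ∞) ≤ (RingHom.ker φ).height := le_height_ker_of_isIntegral g.toRingHom hg hi _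
  let ι : (MvPolynomial (Fin m) K) →+* MvPolynomial (Fin m) (MvPolynomial (Fin s) K) :=
    MvPolynomial.map (algebraMap K (MvPolynomial (Fin s) K))
  let _ : Algebra (MvPolynomial (Fin m) K) (MvPolynomial (Fin m) (MvPolynomial (Fin s) K)) :=
    ι.toAlgebra
  have hφι : ∀ r, φ (ι r) = Ideal.Quotient.mk P r := by
    have : φ.comp ι = Ideal.Quotient.mk P := by
      refine MvPolynomial.ringHom_ext (fun a => ?_) fun i => ?_
      · simp only [ι, φ, RingHom.comp_apply, map_C, eval₂Hom_C]
        exact g.commutes a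
      · simp [ι, φ]
    exact fun r => congr($this r)
  have hker : (RingHom.ker φ).IsPrime := RingHom.ker_isPrime φ
  have : (RingHom.ker φ).LiesOver P := ⟨by
    ext r
    rw [Ideal.mem_comap, RingHom.mem_ker]
    change _ ↔ φ (ι r) = 0
    rw [hφι, Ideal.Quotient.eq_zero_iff_mem]⟩
  choose l hl using fun i => Ideal.Quotient.mk_surjective (I := P) (g (X i))
  let T : Set (MvPolynomial (Fin m) (MvPolynomial (Fin s) K)) := Set.range fun i => C (X i) - ι (l i)
  let Q : Ideal (MvPolynomial (Fin m) (MvPolynomial (Fin s) K)) := P.map ι ⊔ Ideal.span T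
  have hQ : Q ≤ RingHom.ker φ := by
    refine sup_le (Ideal.map_le_iff_le_comap.2 fun r hr => ?_) (Ideal.span_le.2 ?_)
    · rw [Ideal.mem_comap, RingHom.mem_ker, hφι, Ideal.Quotient.eq_zero_iff_mem]
      exact hr
    · rintro _ ⟨i, rfl⟩
      change φ _ = 0
      rw [map_sub, hφι, hl]
      simp [φ]
  -- Modulo `Q` every `zᵢ` equals the image of `lᵢ`, so every class is represented by an element of
  -- the original ring.
  have hsurj : ∀ b : MvPolynomial (Fin m) (MvPolynomial (Fin s) K), ∃ r, b - ι r ∈ Q := by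
    let H : Subring (MvPolynomial (Fin m) (MvPolynomial (Fin s) K) ⧸ Q) :=
      ((Ideal.Quotient.mk Q).comp ι).range
    have key : ∀ b : MvPolynomial (Fin m) (MvPolynomial (Fin s) K), Ideal.Quotient.mk Q b ∈ H := by
      intro b
      induction b using MvPolynomial.induction_on with
      | C a =>
        induction a using MvPolynomial.induction_on with
        | C c => exact ⟨C c, by simp [ι, MvPolynomial.algebraMap_eq]⟩
        | add p q hp hq => simpa using H.add_mem hp hq
        | mul_X p i hp =>
          simp only [map_mul]
          refine H.mul_mem hp ⟨l i, ?_⟩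
          rw [RingHom.comp_apply, eq_comm, Ideal.Quotient.eq]
          exact Ideal.mem_sup_right (Ideal.subset_span ⟨i, rfl⟩)
      | add p q hp hq => simpa using H.add_mem hp hq
      | mul_X p i hp =>
        simp only [map_mul]
        exact H.mul_mem hp ⟨X i, by simp [ι]⟩
    intro b
    obtain ⟨r, hr⟩ := key b
    exact ⟨r, by rw [← Ideal.Quotient.eq]; exact hr.symm⟩
  have hQeq : RingHom.ker φ = P.map ι ⊔ Ideal.span T := by
    refine le_antisymm (fun b hb => ?_) hQ
    obtain ⟨r, hr⟩ := hsurj b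
    have h0 : φ (ι r) = 0 := by
      have h3 := hQ hr
      rw [RingHom.mem_ker, map_sub, RingHom.mem_ker.1 hb, zero_sub, neg_eq_zero] at h3
      exact h3
    rw [hφι, Ideal.Quotient.eq_zero_iff_mem] at h0
    have := Q.add_mem hr (Ideal.mem_sup_left (Ideal.mem_map_of_mem ι h0))
    simpa using this
  have h2 := Ideal.height_le_height_add_of_liesOver P (RingHom.ker φ)
  -- Krull's height theorem: modulo the extension of `P`, the kernel is generated by `s` elements.
  have h3 : ((RingHom.ker φ).map (Ideal.Quotient.mk (P.map (algebraMap (MvPolynomial (Fin m) K) (MvPolynomial (Fin m) (MvPolynomial (Fin s) K)))))).height ≤ s := by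
    have hne : ((RingHom.ker φ).map (Ideal.Quotient.mk (P.map (algebraMap (MvPolynomial (Fin m) K) (MvPolynomial (Fin m) (MvPolynomial (Fin s) K)))))) ≠ ⊤ := by
      have : (Ideal.map (Ideal.Quotient.mk (P.map (algebraMap (MvPolynomial (Fin m) K) (MvPolynomial (Fin m) (MvPolynomial (Fin s) K))))) (RingHom.ker φ)).IsPrime :=
        Ideal.isPrime_map_quotientMk_of_isPrime (le_sup_left.trans hQeq.ge)
      exact this.ne_top
    refine (Ideal.height_le_spanFinrank _ hne).trans ?_
    have he : ((RingHom.ker φ).map (Ideal.Quotient.mk (P.map (algebraMap (MvPolynomial (Fin m) K) (MvPolynomial (Fin m) (MvPolynomial (Fin s) K)))))) =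
        Ideal.span (Set.range fun i => Ideal.Quotient.mk (P.map (algebraMap (MvPolynomial (Fin m) K) (MvPolynomial (Fin m) (MvPolynomial (Fin s) K))))
          (C (X i) - ι (l i))) := by
      rw [hQeq, Ideal.map_sup, Ideal.map_span, ← Set.range_comp]
      have : Ideal.map (Ideal.Quotient.mk (Ideal.map (algebraMap (MvPolynomial (Fin m) K) (MvPolynomial (Fin m) (MvPolynomial (Fin s) K))) P)) (Ideal.map ι P) = ⊥ :=
        Ideal.map_quotient_self _
      rw [this, bot_sup_eq]
      rfl
    rw [he]
    refine (Submodule.spanFinrank_span_le_encard _).trans ?_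
    rw [← Set.image_univ]
    refine (Set.encard_image_le _ _).trans ?_
    simp
  have h4 : (m : ℕ∞) ≤ s + P.height := by
    rw [add_comm]
    exact h1.trans (h2.trans (by gcongr))
  calc (m : WithBot ℕ∞) ≤ ((s + P.height : ℕ∞) : WithBot ℕ∞) := by exact_mod_cast h4
    _ = s + P.height := by push_cast; rfl
    _ ≤ _ := by gcongr

theorem le_ringKrullDim_quotient_add_height {m : ℕ} (I : Ideal (MvPolynomial (Fin m) K))
    (hI : I ≠ ⊤) : (m : WithBot ℕ∞) ≤ ringKrullDim (MvPolynomial (Fin m) K ⧸ I) + I.height := by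
  have hfin : I.height ≠ ⊤ := Ideal.height_ne_top hI
  obtain ⟨h, hh⟩ := ENat.ne_top_iff_exists.1 hfin
  obtain ⟨P, hP, hIP, hPh⟩ := Ideal.exists_isPrime_height_eq hh.symm
  refine (le_ringKrullDim_quotient_add_height_of_isPrime P).trans ?_
  rw [hPh, ← hh]
  gcongr
  exact ringKrullDim_le_of_surjective (Ideal.Quotient.factor hIP)
    (Ideal.Quotient.factor_surjective hIP)

/-- A chain of primes over `I` can be prolonged below its first member by a chain as long as the
height of that prime, which is at least `height I`. -/
theorem ringKrullDim_quotient_add_height_le {m : ℕ} (I : Ideal (MvPolynomial (Fin m) K))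
    (hI : I ≠ ⊤) : ringKrullDim (MvPolynomial (Fin m) K ⧸ I) + I.height ≤ m := by
  have := Ideal.Quotient.nontrivial_iff.2 hI
  have hne : Nonempty (PrimeSpectrum.zeroLocus (R := MvPolynomial (Fin m) K) I) := by
    rwa [Set.nonempty_coe_sort, Set.nonempty_iff_ne_empty, ne_eq,
      PrimeSpectrum.zeroLocus_empty_iff_eq_top]
  have hd := MvPolynomial.ringKrullDim_of_isNoetherianRing (R := K) (ι := Fin m)
  simp only [ringKrullDim_eq_zero_of_field, Nat.card_eq_fintype_card, Fintype.card_fin,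
    zero_add] at hd
  rw [← hd, ringKrullDim_quotient, Order.krullDim_eq_iSup_length, ringKrullDim,
    Order.krullDim_eq_iSup_height_add_coheight_of_nonempty, ← WithBot.coe_add,
    ENat.iSup_add, WithBot.coe_le_coe, iSup_le_iff]
  intro l
  refine le_trans ?_ (le_iSup _ l.head.1)
  rw [add_comm]
  gcongr
  · rw [← PrimeSpectrum.height_eq_orderHeight]
    exact Ideal.height_mono l.head.2
  · exact Order.length_le_coheight_head (p := l.map Subtype.val (fun _ _ ↦ id))

end Dimension

/-! ### Hilbert's syzygy theorem -/

section GlobalDimension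

universe u

open CategoryTheory
open scoped Polynomial

variable {S : Type u} [CommRing S]

/-- The map `∑ mᵢ Tⁱ ↦ ∑ Xⁱ mᵢ` from `M[T]` to an `S[X]`-module `M`. -/
noncomputable def polynomialModuleEval (M : Type u) [AddCommGroup M] [Module S M]
    [Module S[X] M] [IsScalarTower S S[X] M] : PolynomialModule S M →ₗ[S[X]] M :=
  (LinearMap.liftBaseChange S[X] (LinearMap.id (R := S) (M := M))).comp
    (PolynomialModule.polynomialTensorProductLEquivPolynomialModule S M).symm.toLinearMap

theorem polynomialModuleEval_single {M : Type u} [AddCommGroup M] [Module S M]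
    [Module S[X] M] [IsScalarTower S S[X] M] (i : ℕ) (m : M) :
    polynomialModuleEval M (PolynomialModule.single S i m) = (Polynomial.X : S[X]) ^ i • m := by
  have h : PolynomialModule.single S i m =
      PolynomialModule.polynomialTensorProductLEquivPolynomialModule S M
        (TensorProduct.tmul S ((Polynomial.X : S[X]) ^ i) m) := by
    change _ = LinearMap.liftBaseChange S[X] (PolynomialModule.lsingle S (M := M) 0) _
    rw [LinearMap.liftBaseChange_tmul, ← Polynomial.monomial_one_right_eq_X_pow,
      PolynomialModule.monomial_smul_lsingle, one_smul, add_zero]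
    rfl
  rw [h, polynomialModuleEval]
  simp

/-- Multiplication by `T - X` on `M[T]`, for an `S[X]`-module `M`. -/
noncomputable def polynomialModuleSub (M : Type u) [AddCommGroup M] [Module S M]
    [Module S[X] M] [IsScalarTower S S[X] M] : PolynomialModule S M →ₗ[S[X]] PolynomialModule S M :=
  LinearMap.lsmul S[X] _ Polynomial.X -
    { PolynomialModule.map S ((LinearMap.lsmul S[X] M Polynomial.X).restrictScalars S) with
      map_smul' := fun p q => by
        have := PolynomialModule.map_smul S ((LinearMap.lsmul S[X] M Polynomial.X).restrictScalars S) p q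
        simpa using this }

theorem polynomialModuleSub_single {M : Type u} [AddCommGroup M] [Module S M]
    [Module S[X] M] [IsScalarTower S S[X] M] (i : ℕ) (m : M) :
    polynomialModuleSub M (PolynomialModule.single S i m) =
      PolynomialModule.single S (i + 1) m - PolynomialModule.single S i ((Polynomial.X : S[X]) • m) := by
  have : (Polynomial.X : S[X]) • PolynomialModule.single S i m = PolynomialModule.single S (i + 1) m := by
    rw [← Polynomial.monomial_one_one_eq_X, PolynomialModule.monomial_smul_single, one_smul, add_comm]
  change (Polynomial.X : S[X]) • _ - PolynomialModule.map S _ _ = _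
  rw [this, PolynomialModule.map_single]
  rfl

theorem coeff_polynomialModuleSub {M : Type u} [AddCommGroup M] [Module S M]
    [Module S[X] M] [IsScalarTower S S[X] M] (i : ℕ) (p : PolynomialModule S M) :
    (polynomialModuleSub M p).coeff (i + 1) = p.coeff i - (Polynomial.X : S[X]) • p.coeff (i + 1) := by
  induction p using PolynomialModule.induction_linear with
  | zero => simp
  | add p q hp hq => simp [hp, hq, smul_add]; abel
  | single j m =>
    rw [polynomialModuleSub_single]
    change (Finsupp.single (j + 1) m - Finsupp.single j ((Polynomial.X : S[X]) • m)) (i + 1) =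
      Finsupp.single j m i - (Polynomial.X : S[X]) • Finsupp.single j m (i + 1)
    simp [Finsupp.single_apply, smul_ite]

/-- For `p` in the kernel, each coefficient is `X` times the next one; as the high coefficients
vanish, all do. -/
theorem polynomialModuleSub_injective {M : Type u} [AddCommGroup M] [Module S M]
    [Module S[X] M] [IsScalarTower S S[X] M] : Function.Injective (polynomialModuleSub (S := S) M) := by
  rw [injective_iff_map_eq_zero]
  intro p hp
  by_contra hne
  have h1 : ∀ i, p.coeff i = (Polynomial.X : S[X]) • p.coeff (i + 1) := fun i => by
    have := coeff_polynomialModuleSub i p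
    rw [hp] at this
    exact (sub_eq_zero.1 (by simpa using this.symm))
  have h2 : ∀ k i, p.coeff (i + k) = 0 → p.coeff i = 0 := by
    intro k
    induction k with
    | zero => exact fun i h => h
    | succ k ih => exact fun i h => ih i (by rw [h1, add_assoc, h, smul_zero])
  apply hne
  ext i
  refine h2 (p.coeff.support.sup id + 1) i ?_
  by_contra h
  have := Finset.le_sup (f := id) (Finsupp.mem_support_iff.2 h)
  simp only [id] at this
  omega

/-- Modulo the image of `T - X`, the variable `T` may be replaced by the action of `X`, so `p` is
congruent to the constant given by its value. -/
theorem polynomialModule_exact {M : Type u} [AddCommGroup M] [Module S M]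
    [Module S[X] M] [IsScalarTower S S[X] M] :
    Function.Exact (polynomialModuleSub (S := S) M) (polynomialModuleEval M) := by
  rw [LinearMap.exact_iff]
  refine le_antisymm (fun p hp => ?_) ?_
  · have key : ∀ p : PolynomialModule S M, p - PolynomialModule.single S 0 (polynomialModuleEval M p) ∈
        LinearMap.range (polynomialModuleSub (S := S) M) := by
      intro p
      induction p using PolynomialModule.induction_linear with
      | zero => simp
      | add p q hp hq =>
        convert! add_mem hp hq using 1
        simp
        abel
      | single i m =>
        induction i generalizing m with
        | zero => simp [polynomialModuleEval_single]
        | succ i ih =>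
          convert! add_mem (ih ((Polynomial.X : S[X]) • m)) ⟨PolynomialModule.single S i m, rfl⟩ using 1
          rw [polynomialModuleSub_single, polynomialModuleEval_single, polynomialModuleEval_single,
            smul_smul, pow_succ]
          abel
    have := key p
    rwa [LinearMap.mem_ker.1 hp, PolynomialModule.single_zero, sub_zero] at this
  · rintro _ ⟨p, rfl⟩
    rw [LinearMap.mem_ker]
    induction p using PolynomialModule.induction_linear with
    | zero => simp
    | add p q hp hq => simp [hp, hq]
    | single i m =>
      rw [polynomialModuleSub_single, map_sub, polynomialModuleEval_single,
        polynomialModuleEval_single, smul_smul, pow_succ, sub_self]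

theorem polynomialModuleEval_surjective {M : Type u} [AddCommGroup M] [Module S M]
    [Module S[X] M] [IsScalarTower S S[X] M] :
    Function.Surjective (polynomialModuleEval (S := S) M) :=
  fun m => ⟨PolynomialModule.single S 0 m, by simp [polynomialModuleEval_single]⟩

/-- Base change to `S[X]` is flat and preserves projectives, so it carries a projective presentation
to one and the bound passes along the syzygies. -/
theorem hasProjectiveDimensionLE_tensor (d : ℕ) (M : ModuleCat.{u} S)
    [HasProjectiveDimensionLE M d] :
    HasProjectiveDimensionLE (ModuleCat.of S[X] (TensorProduct S S[X] M)) d := by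
  induction d generalizing M with
  | zero =>
    have projle : HasProjectiveDimensionLE M 0 := ‹_›
    simp only [HasProjectiveDimensionLE, zero_add] at projle ⊢
    rw [← projective_iff_hasProjectiveDimensionLT_one, ← IsProjective.iff_projective] at projle ⊢
    infer_instance
  | succ d ih =>
    let T := M.projectiveShortComplex
    have hT : T.ShortExact := M.shortExact_projectiveShortComplex
    have h1 : HasProjectiveDimensionLE T.X₁ d :=
      (hT.hasProjectiveDimensionLT_X₃_iff d inferInstance).mp ‹_›
    let T' : ShortComplex (ModuleCat.{u} S[X]) := ModuleCat.shortComplexOfCompEqZero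
      (T.f.hom.baseChange S[X]) (T.g.hom.baseChange S[X]) (by
        rw [← LinearMap.baseChange_comp, ← ModuleCat.hom_comp, T.zero]
        simp)
    have hT' : T'.ShortExact := ModuleCat.shortComplex_shortExact _
      (Module.Flat.lTensor_exact S[X]
        ((ShortComplex.ShortExact.moduleCat_exact_iff_function_exact T).1 hT.exact))
      (Module.Flat.lTensor_preserves_injective_linearMap _ hT.moduleCat_injective_f)
      (LinearMap.lTensor_surjective _ hT.moduleCat_surjective_g)
    have hp : Projective T'.X₂ := by
      rw [← IsProjective.iff_projective]
      change Module.Projective S[X] (TensorProduct S S[X] T.X₂)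
      infer_instance
    exact (hT'.hasProjectiveDimensionLT_X₃_iff d hp).mpr (ih T.X₁)

/-- The sequence `0 → M[T] → M[T] → M → 0` resolves `M` by modules extended from `S`, of projective
dimension at most `d`; the cokernel costs one more. -/
theorem hasProjectiveDimensionLE_polynomial (d : ℕ)
    (h : ∀ M : ModuleCat.{u} S, HasProjectiveDimensionLE M d) (M : ModuleCat.{u} S[X]) :
    HasProjectiveDimensionLE M (d + 1) := by
  let _ : Module S M := Module.compHom M (Polynomial.C : S →+* S[X])
  have : IsScalarTower S S[X] M := ⟨fun a p m => by
    change (a • p) • m = (Polynomial.C a) • p • m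
    rw [smul_smul, Polynomial.smul_eq_C_mul]⟩
  have h1 : HasProjectiveDimensionLE (ModuleCat.of S[X] (PolynomialModule S M)) d := by
    have := h (ModuleCat.of S M)
    have := hasProjectiveDimensionLE_tensor d (ModuleCat.of S M)
    exact ModuleCat.hasProjectiveDimensionLE_of_linearEquiv (M := (ModuleCat.of S[X] (TensorProduct S S[X] M)))
      (PolynomialModule.polynomialTensorProductLEquivPolynomialModule S M) d
  let T : ShortComplex (ModuleCat.{u} S[X]) := ModuleCat.shortComplexOfCompEqZero
    (polynomialModuleSub (S := S) M) (polynomialModuleEval M)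
    polynomialModule_exact.linearMap_comp_eq_zero
  have hT : T.ShortExact := ModuleCat.shortComplex_shortExact _ polynomialModule_exact
    polynomialModuleSub_injective polynomialModuleEval_surjective
  exact hT.hasProjectiveDimensionLT_X₃ (d + 1) h1
    (hasProjectiveDimensionLT_of_ge _ (d + 1) _ (by omega))

attribute [local instance] RingHomInvPair.of_ringEquiv in
theorem hasProjectiveDimensionLE_of_ringEquiv {S' : Type u} [CommRing S'] (e : S ≃+* S') (d : ℕ)
    (h : ∀ M : ModuleCat.{u} S, HasProjectiveDimensionLE M d) (M : ModuleCat.{u} S') :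
    HasProjectiveDimensionLE M d := by
  let _ : Module S M := Module.compHom M (e : S →+* S')
  let e' : (ModuleCat.of S M) ≃ₛₗ[RingHomClass.toRingHom e] M :=
    { AddEquiv.refl M with map_smul' := fun r m => rfl }
  have := h (ModuleCat.of S M)
  exact ModuleCat.hasProjectiveDimensionLE_of_semiLinearEquiv e e' d

/-- **Hilbert's syzygy theorem**: modules over `K[x₁, …, x_k]` have projective dimension
at most `k`. -/
theorem hasProjectiveDimensionLE_mvPolynomial {K : Type u} [Field K] (k : ℕ)
    (M : ModuleCat.{u} (MvPolynomial (Fin k) K)) : HasProjectiveDimensionLE M k := by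
  induction k with
  | zero =>
    refine hasProjectiveDimensionLE_of_ringEquiv (isEmptyRingEquiv K (Fin 0)).symm 0
      (fun N => ?_) M
    have : Projective N := by
      rw [← IsProjective.iff_projective]
      exact Module.Projective.of_free (P := N) (R := K)
    exact (projective_iff_hasProjectiveDimensionLE_zero N).1 this
  | succ k ih =>
    exact hasProjectiveDimensionLE_of_ringEquiv (finSuccEquiv K k).symm.toRingEquiv (k + 1)
      (hasProjectiveDimensionLE_polynomial k ih) M

end GlobalDimension

/-! ### Ext groups and regular sequences -/

section ExtRegular

universe u

open CategoryTheory Abelian RingTheory.Sequence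

variable {R : Type u} [CommRing R]

theorem subsingleton_ext_of_iso {M M' : ModuleCat.{u} R} (e : M ≅ M') (N : ModuleCat.{u} R) (i : ℕ)
    (h : Subsingleton (Ext M N i)) : Subsingleton (Ext M' N i) := by
  refine subsingleton_of_forall_eq 0 fun x => ?_
  have : x = (Ext.mk₀ e.inv).comp ((Ext.mk₀ e.hom).comp x (zero_add i)) (zero_add i) := by simp
  rw [this, h.elim ((Ext.mk₀ e.hom).comp x (zero_add i)) 0, Ext.comp_zero]

theorem smul_ext_eq_zero {M N : ModuleCat.{u} R} {r : R} (hr : r ∈ Module.annihilator R N) {i : ℕ}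
    (x : Ext M N i) : r • x = 0 := by
  have : r • 𝟙 N = 0 := by
    ext m
    exact Module.mem_annihilator.1 hr m
  rw [Ext.smul_eq_comp_mk₀, this, Ext.mk₀_zero, Ext.comp_zero]

/-- If `r` is regular on `M` and kills `N`, then `Ext M N i` embeds into
`Ext (M / r M) N (i + 1)`. -/
theorem subsingleton_ext_of_quotSMulTop {M N : ModuleCat.{u} R} {r : R}
    (hr : r ∈ Module.annihilator R N) (hreg : IsSMulRegular M r) (i : ℕ)
    (h : Subsingleton (Ext (ModuleCat.of R (QuotSMulTop r M)) N (i + 1))) :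
    Subsingleton (Ext M N i) := by
  refine subsingleton_of_forall_eq 0 fun x => ?_
  have hS := hreg.smulShortComplex_shortExact
  obtain ⟨y, rfl⟩ := Ext.contravariant_sequence_exact₁ hS _ x (add_comm 1 i)
    (h.elim (hS.extClass.comp x (add_comm 1 i)) 0)
  change (Ext.mk₀ (r • 𝟙 M)).comp (show Ext M N i from y) (zero_add i) = 0
  rw [Ext.mk₀_smul, Ext.smul_comp]
  exact smul_ext_eq_zero hr _

theorem subsingleton_ext_X₃ {S : ShortComplex (ModuleCat.{u} R)} (hS : S.ShortExact)
    {N : ModuleCat.{u} R} {i : ℕ} (h₁ : Subsingleton (Ext S.X₁ N i))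
    (h₂ : Subsingleton (Ext S.X₂ N (i + 1))) : Subsingleton (Ext S.X₃ N (i + 1)) := by
  refine subsingleton_of_forall_eq 0 fun x => ?_
  obtain ⟨y, hy⟩ := Ext.contravariant_sequence_exact₃ hS _ x (h₂.elim _ _) (add_comm 1 i)
  rw [← hy, h₁.elim y 0, Ext.comp_zero]

theorem subsingleton_ext_X₂ {S : ShortComplex (ModuleCat.{u} R)} (hS : S.ShortExact)
    {N : ModuleCat.{u} R} {i : ℕ} (h₁ : Subsingleton (Ext S.X₁ N i))
    (h₃ : Subsingleton (Ext S.X₃ N i)) : Subsingleton (Ext S.X₂ N i) := by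
  refine subsingleton_of_forall_eq 0 fun x => ?_
  obtain ⟨y, hy⟩ := Ext.contravariant_sequence_exact₂ hS _ x (h₁.elim _ _)
  rw [← hy, h₃.elim y 0, Ext.comp_zero]

theorem subsingleton_ext_X₁ {S : ShortComplex (ModuleCat.{u} R)} (hS : S.ShortExact)
    {N : ModuleCat.{u} R} {i : ℕ} (h₂ : Subsingleton (Ext S.X₂ N i))
    (h₃ : Subsingleton (Ext S.X₃ N (i + 1))) : Subsingleton (Ext S.X₁ N i) := by
  refine subsingleton_of_forall_eq 0 fun x => ?_
  obtain ⟨y, hy⟩ := Ext.contravariant_sequence_exact₁ hS _ x (add_comm 1 i) (h₃.elim _ _)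
  rw [← hy, h₂.elim y 0, Ext.comp_zero]

theorem subsingleton_ext_quotSMulTop {M N : ModuleCat.{u} R} {r : R} (hreg : IsSMulRegular M r)
    (i : ℕ) (h : Subsingleton (Ext M N i)) (h' : Subsingleton (Ext M N (i + 1))) :
    Subsingleton (Ext (ModuleCat.of R (QuotSMulTop r M)) N (i + 1)) :=
  subsingleton_ext_X₃ hreg.smulShortComplex_shortExact h h'

/-- Each element of the sequence raises the Ext degree by one. Vanishing far up, where the syzygy
theorem applies, thus descends to `M`. -/
theorem subsingleton_ext_of_isWeaklyRegular {M N : ModuleCat.{u} R} (rs : List R)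
    (hrs : ∀ r ∈ rs, r ∈ Module.annihilator R N) (hreg : IsWeaklyRegular M rs) (i : ℕ)
    (h : Subsingleton (Ext (ModuleCat.of R (M ⧸ (Ideal.ofList rs • ⊤ : Submodule R M))) N
      (i + rs.length))) :
    Subsingleton (Ext M N i) := by
  induction rs generalizing M i with
  | nil =>
    refine subsingleton_ext_of_iso (LinearEquiv.toModuleIso ?_) N i h
    exact Submodule.quotEquivOfEqBot _ (by simp)
  | cons r rs ih =>
    rw [isWeaklyRegular_cons_iff] at hreg
    refine subsingleton_ext_of_quotSMulTop (hrs r (by simp)) hreg.1 i ?_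
    refine ih (fun s hs => hrs s (by simp [hs])) hreg.2 (i + 1) ?_
    rw [List.length_cons, ← add_assoc, add_right_comm] at h
    exact subsingleton_ext_of_iso (LinearEquiv.toModuleIso
      (Submodule.quotOfListConsSMulTopEquivQuotSMulTopInner M r rs)) N _ h

/-- If `M` has no `M`-regular element in the maximal ideal `𝔪`, then `Ext M (R/𝔪) D` is nonzero
for `D` the top degree. -/
theorem exists_isSMulRegular_of_subsingleton_ext [IsNoetherianRing R] {m : Ideal R}
    [hm : m.IsMaximal] {D : ℕ}
    (hD : ¬ Subsingleton (Ext (ModuleCat.of R (R ⧸ m)) (ModuleCat.of R (R ⧸ m)) D))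
    (hD' : ∀ M : ModuleCat.{u} R, Subsingleton (Ext M (ModuleCat.of R (R ⧸ m)) (D + 1)))
    (M : ModuleCat.{u} R) [Module.Finite R M]
    (h : Subsingleton (Ext M (ModuleCat.of R (R ⧸ m)) D)) : ∃ r ∈ m, IsSMulRegular M r := by
  -- An element of `𝔪` regular on `M` exists exactly when `Hom(R/𝔪, M) = 0`. A nonzero map would
  -- embed the simple module `R/𝔪` in `M`, and `Ext^D(R/𝔪, R/𝔪)` would lie between two zero groups.
  have key := IsSMulRegular.subsingleton_linearMap_iff (R := R) (M := M) (N := R ⧸ m)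
  rw [Ideal.annihilator_quotient] at key
  rw [← key]
  refine subsingleton_of_forall_eq 0 fun f => ?_
  by_contra hf
  have : IsSimpleModule R (R ⧸ m) := isSimpleModule_iff_isCoatom.2 hm.1
  have hinj : Function.Injective f := (f.injective_or_eq_zero).resolve_right hf
  let S : ShortComplex (ModuleCat.{u} R) := ModuleCat.shortComplexOfCompEqZero f
    (LinearMap.range f).mkQ (LinearMap.range_mkQ_comp f)
  have hS : S.ShortExact := ModuleCat.shortComplex_shortExact _
    (LinearMap.exact_map_mkQ_range f) hinj (Submodule.mkQ_surjective _)
  exact hD (subsingleton_ext_X₁ hS h (hD' _))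

/-- Vanishing in the top degree `D` supplies a regular element `r`, and by the long exact sequence
`M / r M` inherits the vanishing in all but the lowest degree of the range. Hence `d` vanishing
degrees yield `d` elements. -/
theorem exists_isWeaklyRegular_of_subsingleton_ext [IsNoetherianRing R] {m : Ideal R}
    [hm : m.IsMaximal] {D : ℕ}
    (hD : ¬ Subsingleton (Ext (ModuleCat.of R (R ⧸ m)) (ModuleCat.of R (R ⧸ m)) D))
    (hD' : ∀ M : ModuleCat.{u} R, Subsingleton (Ext M (ModuleCat.of R (R ⧸ m)) (D + 1)))
    (d : ℕ) (hd : d ≤ D) (M : ModuleCat.{u} R) [Module.Finite R M]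
    (h : ∀ i ≤ D, D < i + d → Subsingleton (Ext M (ModuleCat.of R (R ⧸ m)) i)) :
    ∃ rs : List R, (∀ r ∈ rs, r ∈ m) ∧ IsWeaklyRegular M rs ∧ rs.length = d := by
  induction d generalizing M with
  | zero => exact ⟨[], by simp, IsWeaklyRegular.nil R M, rfl⟩
  | succ d ih =>
    obtain ⟨r, hr, hreg⟩ := exists_isSMulRegular_of_subsingleton_ext hD hD' M
      (h D le_rfl (by omega))
    obtain ⟨rs, h1, h2, h3⟩ := ih (by omega) (ModuleCat.of R (QuotSMulTop r M)) (by
      rintro (_ | i) hi hid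
      · omega
      · exact subsingleton_ext_quotSMulTop hreg i (h i (by omega) (by omega))
          (h (i + 1) hi (by omega)))
    exact ⟨r :: rs, by simpa using ⟨hr, h1⟩, IsWeaklyRegular.cons hreg h2, by simp [h3]⟩

/-- A regular element avoids the minimal primes of the support, so dividing by it lowers the
dimension by at least one. -/
theorem length_le_supportDim_of_isRegular {M : Type u} [AddCommGroup M] [Module R M]
    [Module.Finite R M] [IsNoetherianRing R] (rs : List R) (h : IsRegular M rs) :
    (rs.length : WithBot ℕ∞) ≤ Module.supportDim R M := by
  induction rs generalizing M with
  | nil =>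
    have := h.nontrivial
    have : Module.supportDim R M ≠ ⊥ := Module.supportDim_ne_bot_of_nontrivial R M
    rw [List.length_nil, Nat.cast_zero]
    exact not_lt.1 fun h => this ((WithBot.lt_zero_iff_eq_bot _).1 h)
  | cons r rs ih =>
    rw [isRegular_cons_iff] at h
    have := ih h.2
    refine le_trans ?_ (Module.supportDim_quotSMulTop_succ_le_of_notMem_minimalPrimes
      (R := R) (M := M) (x := r) fun _ hp => h.1.notMem_of_mem_minimalPrimes hp)
    rw [List.length_cons]
    push_cast
    gcongr

end ExtRegular

/-! ### The residue field and its top Ext group -/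

section Residue

universe u

open CategoryTheory Abelian RingTheory.Sequence

variable {K : Type u} [Field K] {n : ℕ}

theorem mem_idealOfVars_iff {f : CoordRing K n} :
    f ∈ idealOfVars (Fin (n + 1)) K ↔ constantCoeff f = 0 := by
  rw [← pow_one (idealOfVars (Fin (n + 1)) K), mem_pow_idealOfVars_iff', constantCoeff_eq]
  refine ⟨fun h => h 0 (by simp), fun h x hx => ?_⟩
  rw [Nat.lt_one_iff, Finsupp.degree_eq_zero_iff] at hx
  rw [hx, h]

instance : (idealOfVars (Fin (n + 1)) K).IsMaximal := by
  have : idealOfVars (Fin (n + 1)) K = RingHom.ker (constantCoeff (σ := Fin (n + 1)) (R := K)) := by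
    ext f
    rw [mem_idealOfVars_iff, RingHom.mem_ker]
  rw [this]
  exact RingHom.ker_isMaximal_of_surjective _ fun a => ⟨C a, constantCoeff_C _ a⟩

/-- The residue field `R/𝔪`. -/
noncomputable abbrev residue (K : Type u) [Field K] (n : ℕ) : ModuleCat.{u} (CoordRing K n) :=
  ModuleCat.of _ (CoordRing K n ⧸ idealOfVars (Fin (n + 1)) K)

/-- Membership in an ideal generated by variables is tested monomial by monomial, and multiplying by
a further variable does not affect the test. -/
theorem isWeaklyRegular_vars :
    IsWeaklyRegular (CoordRing K n) (List.ofFn (X : Fin (n + 1) → CoordRing K n)) := by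
  refine ⟨fun i hi => ?_⟩
  have hI : Ideal.ofList ((List.ofFn (X : Fin (n + 1) → CoordRing K n)).take i) =
      Ideal.span (X '' {j : Fin (n + 1) | (j : ℕ) < i}) := by
    refine congrArg Ideal.span (Set.ext fun p => ?_)
    rw [Set.mem_ofPred_eq, List.mem_take_iff_getElem, Set.mem_image]
    simp only [List.getElem_ofFn, List.length_ofFn]
    constructor
    · rintro ⟨j, hj, rfl⟩
      exact ⟨⟨j, by omega⟩, by simp; omega, rfl⟩
    · rintro ⟨j, hj, rfl⟩
      exact ⟨j, lt_min hj j.2, rfl⟩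
  rw [List.length_ofFn] at hi
  rw [smul_eq_mul, Ideal.mul_top, hI, List.getElem_ofFn]
  rw [isSMulRegular_iff_right_eq_zero_of_smul]
  intro y hy
  obtain ⟨f, rfl⟩ := Ideal.Quotient.mk_surjective y
  have hy' : Ideal.Quotient.mk (Ideal.span (X '' {j : Fin (n + 1) | (j : ℕ) < i}))
      (X ⟨i, hi⟩ * f) = 0 := hy
  rw [Ideal.Quotient.eq_zero_iff_mem, mem_ideal_span_X_image] at hy' ⊢
  intro m hm
  obtain ⟨j, hj, hj'⟩ := hy' (Finsupp.single ⟨i, hi⟩ 1 + m) (by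
    rw [mem_support_iff, coeff_X_mul]
    exact mem_support_iff.1 hm)
  refine ⟨j, hj, ?_⟩
  have hne : (⟨i, hi⟩ : Fin (n + 1)) ≠ j := by
    rintro rfl
    simp at hj
  simpa [Finsupp.single_apply, hne] using hj'

theorem subsingleton_ext_of_lt (M N : ModuleCat.{u} (CoordRing K n)) {i : ℕ} (hi : n + 1 < i) :
    Subsingleton (Ext M N i) :=
  have := hasProjectiveDimensionLE_mvPolynomial (n + 1) M
  HasProjectiveDimensionLT.subsingleton M (n + 1 + 1) i hi _

/-- The variables form a regular sequence of length `n + 1` with quotient `k`. Vanishing of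
`Ext^(n+1)(k, k)` would descend along it to `Hom(R, k) = 0`, contradicting the quotient map. -/
theorem not_subsingleton_ext_residue :
    ¬ Subsingleton (Ext (residue K n) (residue K n) (n + 1)) := by
  intro h
  have h1 : Subsingleton (Ext (ModuleCat.of (CoordRing K n) (CoordRing K n)) (residue K n) 0) := by
    refine subsingleton_ext_of_isWeaklyRegular _ ?_ isWeaklyRegular_vars 0 ?_
    · intro r hr
      rw [Ideal.annihilator_quotient]
      obtain ⟨i, rfl⟩ := List.mem_ofFn.1 hr
      exact Ideal.subset_span ⟨i, rfl⟩
    · rw [List.length_ofFn, zero_add]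
      refine subsingleton_ext_of_iso (LinearEquiv.toModuleIso ?_) _ _ h
      refine Submodule.quotEquivOfEq _ _ ?_
      rw [smul_eq_mul, Ideal.mul_top]
      refine congrArg Ideal.span (Set.ext fun p => ?_)
      rw [Set.mem_ofPred_eq, List.mem_ofFn]
      rfl
  have h2 : Subsingleton (ModuleCat.of (CoordRing K n) (CoordRing K n) ⟶ residue K n) :=
    Ext.homEquiv₀.symm.subsingleton
  have h3 := h2.elim (ModuleCat.ofHom (Submodule.mkQ _)) 0
  have h4 := congr($h3 (1 : CoordRing K n))
  exact one_ne_zero (α := CoordRing K n ⧸ idealOfVars (Fin (n + 1)) K) h4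

end Residue

attribute [local instance] MvPolynomial.gradedAlgebra

/-! ### Homogeneous components and minimal generators -/

section GradedComponents

variable {K : Type*} [Field K] {n : ℕ}

/-- The homogeneous component of degree `e` of a polynomial, for an integer `e`. -/
noncomputable def intComponent (e : ℤ) (f : CoordRing K n) : CoordRing K n :=
  -- Negative degrees arise as `e - s k`; without the test, `toNat` would send them to degree zero.
  if 0 ≤ e then homogeneousComponent e.toNat f else 0

theorem coeff_intComponent (e : ℤ) (f : CoordRing K n) (m : Fin (n + 1) →₀ ℕ) :
    coeff m (intComponent e f) = if (m.degree : ℤ) = e then coeff m f else 0 := by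
  unfold intComponent
  split_ifs with h1 h2 h2
  · rw [coeff_homogeneousComponent, if_pos (by omega)]
  · rw [coeff_homogeneousComponent, if_neg (by omega)]
  · omega
  · simp

theorem intComponent_sum (e : ℤ) {ι : Type*} (t : Finset ι) (f : ι → CoordRing K n) :
    intComponent e (∑ i ∈ t, f i) = ∑ i ∈ t, intComponent e (f i) := by
  ext m
  simp only [coeff_intComponent, coeff_sum]
  split_ifs <;> simp

theorem intComponent_mul {a : ℤ} {p : CoordRing K n} (hp : ∀ m ∈ p.support, (m.degree : ℤ) = a)
    (e : ℤ) (q : CoordRing K n) : intComponent e (p * q) = p * intComponent (e - a) q := by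
  ext m
  have key : ∀ x ∈ Finset.HasAntidiagonal.antidiagonal m,
      coeff x.1 p * coeff x.2 (intComponent (e - a) q) =
      if (m.degree : ℤ) = e then coeff x.1 p * coeff x.2 q else 0 := by
    rintro ⟨u, w⟩ hx
    rw [Finset.HasAntidiagonal.mem_antidiagonal] at hx
    dsimp only at hx ⊢
    by_cases hu : coeff u p = 0
    · simp [hu]
    have h1 := hp u (mem_support_iff.2 hu)
    have h2 : m.degree = u.degree + w.degree := by rw [← hx, map_add]
    rw [coeff_intComponent]
    split_ifs <;> first | rfl | omega | simp
  rw [coeff_intComponent, coeff_mul, coeff_mul, Finset.sum_congr rfl key]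
  split_ifs <;> simp

theorem intComponent_zero (f : CoordRing K n) : intComponent 0 f = C (constantCoeff f) := by
  ext m
  rw [coeff_intComponent, coeff_C, constantCoeff_eq]
  by_cases h : m = 0
  · simp [h]
  · rw [if_neg (by simpa [Finsupp.degree_eq_zero_iff] using h), if_neg (Ne.symm h)]

variable {ι : Type*}

/-- `v ∈ ⨁ₖ R(-s k)` is homogeneous of degree `e`. -/
def IsHomogeneousVector (s : ι → ℤ) (e : ℤ) (v : ι → CoordRing K n) : Prop :=
  ∀ k, ∀ m ∈ (v k).support, s k + (m.degree : ℤ) = e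

/-- The component of degree `e` of a vector in `⨁ₖ R(-s k)`. -/
noncomputable def vectorComponent (s : ι → ℤ) (e : ℤ) (v : ι → CoordRing K n) :
    ι → CoordRing K n :=
  fun k => intComponent (e - s k) (v k)

theorem isHomogeneousVector_vectorComponent (s : ι → ℤ) (e : ℤ) (v : ι → CoordRing K n) :
    IsHomogeneousVector s e (vectorComponent s e v) := by
  intro k m hm
  rw [mem_support_iff, vectorComponent, coeff_intComponent] at hm
  have := (ite_ne_right_iff.1 hm).1
  omega

theorem exists_sum_vectorComponent [Fintype ι] (s : ι → ℤ) (v : ι → CoordRing K n) :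
    ∃ E : Finset ℤ, v = ∑ e ∈ E, vectorComponent s e v := by
  classical
  refine ⟨Finset.univ.biUnion fun k => (v k).support.image fun m => s k + (m.degree : ℤ), ?_⟩
  ext k m
  rw [Finset.sum_apply, coeff_sum]
  simp only [vectorComponent, coeff_intComponent]
  by_cases h : coeff m (v k) = 0
  · simp [h]
  · rw [Finset.sum_eq_single (s k + (m.degree : ℤ)), if_pos (by ring)]
    · intro e _ he
      rw [if_neg]
      omega
    · intro hn
      refine absurd (Finset.mem_biUnion.2 ⟨k, Finset.mem_univ _, Finset.mem_image.2
        ⟨m, mem_support_iff.2 h, rfl⟩⟩) hn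

theorem vectorComponent_sum_smul {r : ℕ} {s : ι → ℤ} {t : Fin r → ℤ}
    {v : Fin r → ι → CoordRing K n} (hv : ∀ l, IsHomogeneousVector s (t l) (v l)) (e : ℤ) (f : Fin r → CoordRing K n) :
    vectorComponent s e (∑ l, f l • v l) = ∑ l, vectorComponent t e f l • v l := by
  ext1 k
  simp only [vectorComponent, Finset.sum_apply, Pi.smul_apply, smul_eq_mul, intComponent_sum]
  refine Finset.sum_congr rfl fun l _ => ?_
  rw [mul_comm, intComponent_mul (a := t l - s k) (fun m hm => by have := hv l k m hm; omega),
    mul_comm]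
  congr 2
  ring

theorem exists_homogeneous_generators [Fintype ι] (s : ι → ℤ)
    (N : Submodule (CoordRing K n) (ι → CoordRing K n))
    (hN : ∀ v ∈ N, ∀ e, vectorComponent s e v ∈ N) :
    ∃ (r : ℕ) (t : Fin r → ℤ) (v : Fin r → ι → CoordRing K n),
      (∀ l, IsHomogeneousVector s (t l) (v l)) ∧ Submodule.span _ (Set.range v) = N := by
  let H : Set (ι → CoordRing K n) := {v | v ∈ N ∧ ∃ e, IsHomogeneousVector s e v}
  have hH : Submodule.span (CoordRing K n) H = N := by
    refine le_antisymm (Submodule.span_le.2 fun v hv => hv.1) fun v hv => ?_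
    obtain ⟨E, hE⟩ := exists_sum_vectorComponent s v
    rw [hE]
    exact Submodule.sum_mem _ fun e _ => Submodule.subset_span
      ⟨hN v hv e, e, isHomogeneousVector_vectorComponent s e v⟩
  have hfg : (Submodule.span (CoordRing K n) H).FG := IsNoetherian.noetherian _
  obtain ⟨T, hT, hT'⟩ := (Submodule.fg_span_iff_fg_span_finset_subset H).1 hfg
  let w : Fin T.card → ι → CoordRing K n := fun l => (T.equivFin.symm l : ι → CoordRing K n)
  have hw : ∀ l, ∃ e, IsHomogeneousVector s e (w l) := fun l => (hT (T.equivFin.symm l).2).2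
  choose t ht using hw
  refine ⟨T.card, t, w, ht, ?_⟩
  rw [← hH, hT']
  congr 1
  have : w = Subtype.val ∘ T.equivFin.symm := rfl
  rw [this, Set.range_comp, T.equivFin.symm.surjective.range_eq]
  simp

/-- A graded submodule of a graded free module has homogeneous generators whose
relations have coefficients in `𝔪`. -/
theorem exists_minimal_generators [Fintype ι] (s : ι → ℤ)
    (N : Submodule (CoordRing K n) (ι → CoordRing K n))
    (hN : ∀ v ∈ N, ∀ e, vectorComponent s e v ∈ N) :
    ∃ (r : ℕ) (t : Fin r → ℤ) (v : Fin r → ι → CoordRing K n),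
      (∀ l, IsHomogeneousVector s (t l) (v l)) ∧ Submodule.span _ (Set.range v) = N ∧
      ∀ f : Fin r → CoordRing K n, ∑ l, f l • v l = 0 →
        ∀ l, f l ∈ idealOfVars (Fin (n + 1)) K := by
  classical
  have hex := exists_homogeneous_generators s N hN
  -- Take the least possible number of homogeneous generators: a relation having a coefficient
  -- outside `𝔪` would make one of them redundant.
  obtain ⟨t, v, hv, hspan⟩ := Nat.find_spec hex
  have hmin : ∀ r' < Nat.find hex, _ := fun r' => Nat.find_min hex (m := r')
  generalize Nat.find hex = r at *
  refine ⟨r, t, v, hv, hspan, fun f hf j => ?_⟩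
  by_contra hj
  rw [mem_idealOfVars_iff] at hj
  obtain _ | r := r
  · exact j.elim0
  refine hmin r (Nat.lt_succ_self r) ⟨t ∘ j.succAbove, v ∘ j.succAbove, fun l => hv _, ?_⟩
  rw [← hspan]
  refine le_antisymm (Submodule.span_mono (Set.range_comp_subset_range _ _))
    (Submodule.span_le.2 ?_)
  -- In degree `t j` the coefficient of `v j` in the relation becomes the constant term of `f j`, an
  -- invertible scalar.
  have hg := vectorComponent_sum_smul hv (t j) f
  have h0 : vectorComponent s (t j) (0 : ι → CoordRing K n) = 0 := by
    ext k m
    simp [vectorComponent, coeff_intComponent]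
  rw [hf, h0, Fin.sum_univ_succAbove _ j, vectorComponent, sub_self, intComponent_zero] at hg
  have hvj : v j ∈ Submodule.span (CoordRing K n) (Set.range (v ∘ j.succAbove)) := by
    have hmem : ∑ l, vectorComponent t (t j) f (j.succAbove l) • v (j.succAbove l) ∈
        Submodule.span (CoordRing K n) (Set.range (v ∘ j.succAbove)) :=
      Submodule.sum_mem _ fun l _ => Submodule.smul_mem _ _ (Submodule.subset_span ⟨l, rfl⟩)
    have hC : (C (constantCoeff (f j)) : CoordRing K n) • v j ∈
        Submodule.span (CoordRing K n) (Set.range (v ∘ j.succAbove)) := by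
      rw [eq_neg_of_add_eq_zero_left hg.symm]
      exact neg_mem hmem
    have := Submodule.smul_mem _ (C (constantCoeff (f j))⁻¹ : CoordRing K n) hC
    rwa [smul_smul, ← C_mul, inv_mul_cancel₀ hj, C_1, one_smul] at this
  rintro _ ⟨l, rfl⟩
  by_cases h : l = j
  · rw [h]; exact hvj
  · obtain ⟨l', rfl⟩ := Fin.exists_succAbove_eq h
    exact Submodule.subset_span ⟨l', rfl⟩

end GradedComponents

/-! ### Existence of minimal graded free resolutions -/

section Resolution

variable {K : Type*} [Field K] {n : ℕ}

/-- A step `F' ⟶ F` of a graded free resolution whose kernel is contained in `𝔪 F'`. -/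
structure ResolutionStep (K : Type*) [Field K] (n : ℕ) where
  tgt : ℕ
  src : ℕ
  tgtShift : Fin tgt → ℤ
  srcShift : Fin src → ℤ
  mat : Matrix (Fin tgt) (Fin src) (CoordRing K n)
  graded : ∀ l, IsHomogeneousVector tgtShift (srcShift l) (mat.col l)
  minimal : ∀ f, mat.mulVec f = 0 → ∀ l, f l ∈ idealOfVars (Fin (n + 1)) K

theorem exists_resolutionStep {b : ℕ} (s : Fin b → ℤ)
    (N : Submodule (CoordRing K n) (Fin b → CoordRing K n))
    (hN : ∀ v ∈ N, ∀ e, vectorComponent s e v ∈ N) :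
    ∃ (r : ℕ) (t : Fin r → ℤ) (A : Matrix (Fin b) (Fin r) (CoordRing K n)),
      (∀ l, IsHomogeneousVector s (t l) (A.col l)) ∧
      (∀ f, A.mulVec f = 0 → ∀ l, f l ∈ idealOfVars (Fin (n + 1)) K) ∧
      LinearMap.range A.mulVecLin = N := by
  obtain ⟨r, t, v, h1, h2, h3⟩ := exists_minimal_generators s N hN
  have hmul : ∀ f, (Matrix.of fun k l => v l k).mulVec f = ∑ l, f l • v l := fun f => by
    rw [Matrix.mulVec_eq_sum]
    refine Finset.sum_congr rfl fun l _ => ?_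
    ext1 k
    simp [mul_comm]
  exact ⟨r, t, Matrix.of fun k l => v l k, h1, fun f hf => h3 f (by rw [← hmul, hf]), by
    rw [Matrix.range_mulVecLin, ← h2]; rfl⟩

theorem ResolutionStep.vectorComponent_mem_ker (S : ResolutionStep K n) :
    ∀ v ∈ LinearMap.ker S.mat.mulVecLin, ∀ e, vectorComponent S.srcShift e v ∈
      LinearMap.ker S.mat.mulVecLin := by
  intro v hv e
  have hmul : ∀ f, S.mat.mulVec f = ∑ l, f l • S.mat.col l := fun f => by
    rw [Matrix.mulVec_eq_sum]
    refine Finset.sum_congr rfl fun l _ => ?_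
    ext1 k
    simp [mul_comm]
  rw [LinearMap.mem_ker, Matrix.mulVecLin_apply, hmul] at hv ⊢
  rw [← vectorComponent_sum_smul S.graded, hv]
  ext k m
  simp [vectorComponent, coeff_intComponent]

theorem ResolutionStep.exists_next (S : ResolutionStep K n) :
    ∃ (r : ℕ) (t : Fin r → ℤ) (A : Matrix (Fin S.src) (Fin r) (CoordRing K n)),
      (∀ l, IsHomogeneousVector S.srcShift (t l) (A.col l)) ∧
      (∀ f, A.mulVec f = 0 → ∀ l, f l ∈ idealOfVars (Fin (n + 1)) K) ∧
      LinearMap.range A.mulVecLin = LinearMap.ker S.mat.mulVecLin :=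
  exists_resolutionStep _ _ S.vectorComponent_mem_ker

/-- Continue a resolution by one step. -/
noncomputable def ResolutionStep.next (S : ResolutionStep K n) : ResolutionStep K n where
  tgt := S.src
  src := S.exists_next.choose
  tgtShift := S.srcShift
  srcShift := S.exists_next.choose_spec.choose
  mat := S.exists_next.choose_spec.choose_spec.choose
  graded := S.exists_next.choose_spec.choose_spec.choose_spec.1
  minimal := S.exists_next.choose_spec.choose_spec.choose_spec.2.1

theorem ResolutionStep.range_next (S : ResolutionStep K n) :
    LinearMap.range (S.next.mat.mulVecLin) = LinearMap.ker S.mat.mulVecLin :=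
  S.exists_next.choose_spec.choose_spec.choose_spec.2.2

theorem IsHomogeneousIdeal.intComponent_mem {I : Ideal (CoordRing K n)} (hI : IsHomogeneousIdeal I)
    {f : CoordRing K n} (hf : f ∈ I) (e : ℤ) : intComponent e f ∈ I := by
  unfold intComponent
  split_ifs
  · have h := hI e.toNat hf
    have h' : (DirectSum.decompose (homogeneousSubmodule (Fin (n + 1)) K) f e.toNat :
        CoordRing K n) = homogeneousComponent e.toNat f := decomposition.decompose'_apply f _
    rwa [← h']
  · exact I.zero_mem

theorem mulVecLin_single_one {a b : ℕ} (A : Matrix (Fin a) (Fin b) (CoordRing K n)) (l : Fin b)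
    (k : Fin a) : A.mulVecLin (Pi.single l 1) k = A k l := by
  rw [Matrix.mulVecLin_apply, Matrix.mulVec_single_one, Matrix.col_apply]

/-- Minimal homogeneous generators are chosen for `I` and then for each successive kernel. The first
matrix has entries in `I ≤ 𝔪`; the columns of a later one are relations among minimal generators, so
its entries lie in `𝔪` too. -/
theorem exists_minimalFreeResolution {I : Ideal (CoordRing K n)} (hI : IsHomogeneousIdeal I)
    (hI' : I ≤ idealOfVars (Fin (n + 1)) K) : Nonempty (MinimalFreeResolution I) := by
  let N : Submodule (CoordRing K n) (Fin 1 → CoordRing K n) :=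
    Submodule.comap (LinearMap.proj 0) I
  obtain ⟨r, t, A, h1, h2, h3⟩ := exists_resolutionStep (fun _ : Fin 1 => (0 : ℤ)) N
    fun v hv e => hI.intComponent_mem hv _
  have hA : ∀ l, A 0 l ∈ I := fun l => by
    have h4 : A.mulVecLin (Pi.single l 1) ∈ N := h3 ▸ LinearMap.mem_range_self _ _
    rw [← mulVecLin_single_one A l 0]
    exact h4
  let S₀ : ResolutionStep K n := ⟨1, r, fun _ => 0, t, A, h1, h2⟩
  let S : ℕ → ResolutionStep K n := fun i => Nat.rec S₀ (fun _ T => T.next) i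
  exact ⟨{
    rank := fun i => (S i).tgt
    shift := fun i => (S i).tgtShift
    d := fun i => (S i).mat
    rank_zero := rfl
    shift_zero := fun _ => rfl
    graded := fun i k l => (S i).graded l k
    exact_zero := fun f => by
      change (fun _ => f) ∈ LinearMap.range A.mulVecLin ↔ f ∈ I
      rw [h3]
      rfl
    exact_succ := fun i => LinearMap.exact_iff.2 (S i).range_next.symm
    minimal := fun i k l => by
      obtain _ | i := i
      · have hk : k = (0 : Fin 1) := Subsingleton.elim (α := Fin 1) _ _
        rw [hk]
        exact hI' (hA l)
      · have h4 : (S i).next.mat.mulVecLin (Pi.single l 1) ∈ LinearMap.ker (S i).mat.mulVecLin :=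
          (S i).range_next ▸ LinearMap.mem_range_self _ _
        have h5 := (S i).minimal _ h4 k
        have h6 := mulVecLin_single_one (S i).next.mat l k
        exact h6 ▸ h5 }⟩

end Resolution

/-! ### Dimension shifting -/

section DimensionShift

universe u

open CategoryTheory Abelian

variable {R : Type u} [CommRing R]

/-- Dimension shifting along a short exact sequence `0 ⟶ X₁ ⟶ P ⟶ X₃ ⟶ 0` with `P` projective,
for a module `N` such that all maps `P ⟶ N` vanish on `X₁`. -/
theorem nonempty_ext_equiv_ext_succ {S : ShortComplex (ModuleCat.{u} R)} (hS : S.ShortExact)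
    [Projective S.X₂] {N : ModuleCat.{u} R} (h : ∀ g : S.X₂ ⟶ N, S.f ≫ g = 0) (j : ℕ) :
    Nonempty (Ext S.X₁ N j ≃ₗ[R] Ext S.X₃ N (j + 1)) := by
  let φ : Ext S.X₁ N j →ₗ[R] Ext S.X₃ N (j + 1) := hS.extClass.precompOfLinear R N (add_comm 1 j)
  refine ⟨LinearEquiv.ofBijective φ ⟨?_, precomp_extClass_surjective_of_projective_X₂ N hS j⟩⟩
  rw [← LinearMap.ker_eq_bot, LinearMap.ker_eq_bot']
  intro x hx
  obtain ⟨y, rfl⟩ := Ext.contravariant_sequence_exact₁ hS _ x (add_comm 1 j) hx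
  -- In degree zero `y` is a map `P ⟶ N`, which restricts to zero on `X₁` by `h`; in positive
  -- degrees it vanishes because `P` is projective.
  obtain _ | j := j
  · obtain ⟨g, rfl⟩ := (Ext.mk₀_bijective _ _).2 y
    rw [Ext.mk₀_comp_mk₀, h, Ext.mk₀_zero]
  · rw [Ext.eq_zero_of_projective y, Ext.comp_zero]

theorem nonempty_ext_zero_equiv (M N : Type u) [AddCommGroup M] [Module R M] [AddCommGroup N]
    [Module R N] :
    Nonempty (Ext (ModuleCat.of R M) (ModuleCat.of R N) 0 ≃ₗ[R] (M →ₗ[R] N)) :=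
  ⟨Ext.linearEquiv₀.trans ModuleCat.homLinearEquiv⟩

/-- Homs out of `F / L` and `F` agree when all homs out of `F` vanish on `L`. -/
theorem nonempty_quotient_hom_equiv {F N : Type*} [AddCommGroup F] [Module R F] [AddCommGroup N]
    [Module R N] (L : Submodule R F) (h : ∀ g : F →ₗ[R] N, L ≤ LinearMap.ker g) :
    Nonempty ((F ⧸ L →ₗ[R] N) ≃ₗ[R] (F →ₗ[R] N)) := by
  refine ⟨LinearEquiv.ofBijective (LinearMap.lcomp R N L.mkQ) ⟨?_, fun g =>
    ⟨L.liftQ g (h g), L.liftQ_mkQ g (h g)⟩⟩⟩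
  intro f g hfg
  exact LinearMap.cancel_right (Submodule.mkQ_surjective L) |>.1 hfg

theorem nonempty_ext_equiv_of_iso {M M' : ModuleCat.{u} R} (e : M ≅ M') (N : ModuleCat.{u} R)
    (i : ℕ) : Nonempty (Ext M' N i ≃ₗ[R] Ext M N i) := by
  refine ⟨LinearEquiv.ofBijective ((Ext.mk₀ e.hom).precompOfLinear R N (zero_add i))
    ⟨fun x y h => ?_, fun y => ⟨(Ext.mk₀ e.inv).comp y (zero_add i), ?_⟩⟩⟩
  · have := congrArg (fun z => (Ext.mk₀ e.inv).comp z (zero_add i)) h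
    simpa using this
  · simp

end DimensionShift

/-! ### Betti numbers as dimensions of Ext groups -/

section Betti

universe u

open CategoryTheory Abelian

variable {K : Type u} [Field K] {n : ℕ} {I : Ideal (CoordRing K n)}

namespace MinimalFreeResolution

/-- The syzygy `coker (Fᵢ₊₁ ⟶ Fᵢ)` of a minimal free resolution. -/
abbrev Syzygy (F : MinimalFreeResolution I) (i : ℕ) : Type u :=
  (Fin (F.rank i) → CoordRing K n) ⧸ LinearMap.range (F.d i).mulVecLin

/-- This is where minimality enters: the matrix entries lie in `𝔪`, which annihilates the residue
field. -/
theorem range_le_ker (F : MinimalFreeResolution I) (i : ℕ)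
    (g : (Fin (F.rank i) → CoordRing K n) →ₗ[CoordRing K n]
      (CoordRing K n ⧸ idealOfVars (Fin (n + 1)) K)) :
    LinearMap.range (F.d i).mulVecLin ≤ LinearMap.ker g := by
  rw [LinearMap.range_le_ker_iff]
  refine LinearMap.pi_ext' fun l => LinearMap.ext_ring ?_
  have hv : (F.d i).mulVecLin (Pi.single l 1) =
      ∑ k, F.d i k l • (Pi.single k (1 : CoordRing K n) : Fin (F.rank i) → CoordRing K n) := by
    ext1 k
    rw [mulVecLin_single_one, Finset.sum_apply]
    simp [Pi.single_apply]
  change g ((F.d i).mulVecLin (Pi.single l 1)) = 0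
  rw [hv, map_sum]
  refine Finset.sum_eq_zero fun k _ => ?_
  rw [map_smul]
  refine Module.mem_annihilator.1 ?_ _
  rw [Ideal.annihilator_quotient]
  exact F.minimal i k l

theorem nonempty_syzygy_zero_equiv (F : MinimalFreeResolution I) :
    Nonempty (F.Syzygy 0 ≃ₗ[CoordRing K n] (CoordRing K n ⧸ I)) := by
  have : Unique (Fin (F.rank 0)) := by
    rw [F.rank_zero]
    infer_instance
  let φ : (Fin (F.rank 0) → CoordRing K n) →ₗ[CoordRing K n] (CoordRing K n ⧸ I) :=
    (Submodule.mkQ I).comp (LinearMap.proj default)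
  have hφ : Function.Surjective φ := fun y => by
    obtain ⟨f, rfl⟩ := Submodule.mkQ_surjective I y
    exact ⟨fun _ => f, rfl⟩
  have hker : LinearMap.range (F.d 0).mulVecLin = LinearMap.ker φ := by
    ext v
    have hv : v = fun _ => v default := funext fun k => by rw [Unique.eq_default k]
    rw [hv, F.exact_zero]
    exact (Submodule.Quotient.mk_eq_zero I).symm
  exact ⟨(Submodule.quotEquivOfEq _ _ hker).trans (φ.quotKerEquivOfSurjective hφ)⟩

/-- By exactness the next syzygy is the image of `d i` inside `Fᵢ`, and by minimality the dimension
shift is an isomorphism even from degree zero. Shifting down to `j = 0` leaves the maps from `F_m`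
to the residue field. -/
theorem nonempty_ext_syzygy_equiv (F : MinimalFreeResolution I) {i j m : ℕ} (hm : i + j = m) :
    Nonempty (Ext (ModuleCat.of (CoordRing K n) (F.Syzygy i)) (residue K n) j ≃ₗ[CoordRing K n]
      (Fin (F.rank m) → CoordRing K n ⧸ idealOfVars (Fin (n + 1)) K)) := by
  induction j generalizing i with
  | zero =>
    subst hm
    obtain ⟨e₁⟩ := nonempty_ext_zero_equiv (R := CoordRing K n) (F.Syzygy i)
      (CoordRing K n ⧸ idealOfVars (Fin (n + 1)) K)
    obtain ⟨e₂⟩ := nonempty_quotient_hom_equiv _ (F.range_le_ker i)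
    exact ⟨e₁.trans (e₂.trans ((Pi.basisFun (CoordRing K n) _).constr (CoordRing K n)).symm)⟩
  | succ j ih =>
    let f : F.Syzygy (i + 1) →ₗ[CoordRing K n] (Fin (F.rank i) → CoordRing K n) :=
      Submodule.liftQ _ (F.d i).mulVecLin
        (LinearMap.exact_iff.1 (F.exact_succ i)).ge
    have hrange : LinearMap.range f = LinearMap.range (F.d i).mulVecLin :=
      Submodule.range_liftQ _ _ _
    have hinj : Function.Injective f := by
      rw [← LinearMap.ker_eq_bot]
      exact Submodule.ker_liftQ_eq_bot _ _ _ (LinearMap.exact_iff.1 (F.exact_succ i)).le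
    have hexact : Function.Exact f (LinearMap.range (F.d i).mulVecLin).mkQ := by
      rw [LinearMap.exact_iff, Submodule.ker_mkQ, hrange]
    let S : ShortComplex (ModuleCat.{u} (CoordRing K n)) :=
      ModuleCat.shortComplexOfCompEqZero f (LinearMap.range (F.d i).mulVecLin).mkQ
        hexact.linearMap_comp_eq_zero
    have hS : S.ShortExact :=
      ModuleCat.shortComplex_shortExact _ hexact hinj (Submodule.mkQ_surjective _)
    have : Projective S.X₂ := ModuleCat.projective_of_free
      (Pi.basisFun (CoordRing K n) (Fin (F.rank i)))
    obtain ⟨e⟩ := nonempty_ext_equiv_ext_succ hS (N := residue K n) (fun g => by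
      ext1
      exact LinearMap.range_le_ker_iff.1 (hrange.le.trans (F.range_le_ker i g.hom))) j
    obtain ⟨e'⟩ := ih (i := i + 1) (by omega)
    exact ⟨e.symm.trans e'⟩

/-- The ranks in a minimal free resolution are the dimensions of `Ext (R/I) (R/𝔪)`. -/
theorem nonempty_ext_equiv (F : MinimalFreeResolution I) (i : ℕ) :
    Nonempty (Ext (ModuleCat.of (CoordRing K n) (CoordRing K n ⧸ I)) (residue K n) i
      ≃ₗ[CoordRing K n]
      (Fin (F.rank i) → CoordRing K n ⧸ idealOfVars (Fin (n + 1)) K)) := by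
  obtain ⟨e⟩ := F.nonempty_syzygy_zero_equiv
  obtain ⟨e₁⟩ := nonempty_ext_equiv_of_iso (LinearEquiv.toModuleIso e) (residue K n) i
  obtain ⟨e₂⟩ := F.nonempty_ext_syzygy_equiv (zero_add i)
  exact ⟨e₁.trans e₂⟩

theorem subsingleton_ext_iff (F : MinimalFreeResolution I) (i : ℕ) :
    Subsingleton (Ext (ModuleCat.of (CoordRing K n) (CoordRing K n ⧸ I)) (residue K n) i) ↔
      F.rank i = 0 := by
  obtain ⟨e⟩ := F.nonempty_ext_equiv i
  rw [e.toEquiv.subsingleton_congr]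
  refine ⟨fun h => ?_, fun h => ?_⟩
  · by_contra h0
    have : Nonempty (Fin (F.rank i)) := ⟨⟨0, Nat.pos_of_ne_zero h0⟩⟩
    exact not_subsingleton (Fin (F.rank i) → CoordRing K n ⧸ idealOfVars (Fin (n + 1)) K) h
  · rw [h]
    infer_instance

/-- The `i`-th rank is bounded by the `j`-th rank of another resolution if there is a surjection
on `Ext`. -/
theorem rank_le_of_surjective {J : Ideal (CoordRing K n)} (F : MinimalFreeResolution I)
    (G : MinimalFreeResolution J) {i j : ℕ}
    (φ : Ext (ModuleCat.of (CoordRing K n) (CoordRing K n ⧸ I)) (residue K n) i →ₗ[CoordRing K n]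
      Ext (ModuleCat.of (CoordRing K n) (CoordRing K n ⧸ J)) (residue K n) j)
    (hφ : Function.Surjective φ) : G.rank j ≤ F.rank i := by
  obtain ⟨e⟩ := F.nonempty_ext_equiv i
  obtain ⟨e'⟩ := G.nonempty_ext_equiv j
  let k := CoordRing K n ⧸ idealOfVars (Fin (n + 1)) K
  let _ : Field k := Ideal.Quotient.field _
  let ψ : (Fin (F.rank i) → k) →ₗ[CoordRing K n] (Fin (G.rank j) → k) :=
    e'.toLinearMap ∘ₗ φ ∘ₗ e.symm.toLinearMap
  have hψ : Function.Surjective ψ :=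
    e'.surjective.comp (hφ.comp e.symm.surjective)
  -- An `R`-linear map between modules killed by `𝔪` is linear over the residue field, where
  -- surjectivity bounds dimensions.
  let ψ' : (Fin (F.rank i) → k) →ₗ[k] (Fin (G.rank j) → k) :=
    { ψ with
      map_smul' := fun a v => by
        obtain ⟨r, rfl⟩ := Ideal.Quotient.mk_surjective a
        exact ψ.map_smul r v }
  simpa using LinearMap.finrank_le_finrank_of_surjective (f := ψ') hψ

end MinimalFreeResolution

end Betti

/-! ### Cohen–Macaulayness through Ext, and the sum of linked ideals -/

section Gorenstein

universe u

open CategoryTheory Abelian RingTheory.Sequence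

variable {K : Type u} [Field K] {n : ℕ}

/-- An element with nonzero constant term would put its degree-zero component, a unit, in the ideal.
-/
theorem IsHomogeneousIdeal.le_idealOfVars {I : Ideal (CoordRing K n)} (hI : IsHomogeneousIdeal I)
    (hne : I ≠ ⊤) : I ≤ idealOfVars (Fin (n + 1)) K := by
  intro f hf
  rw [mem_idealOfVars_iff]
  by_contra h
  refine hne (Ideal.eq_top_of_isUnit_mem _ (hI.intComponent_mem hf 0) ?_)
  rw [intComponent_zero]
  exact (isUnit_iff_ne_zero.2 h).map C

theorem exists_eq_ringKrullDim_quotient {R : Type*} [CommRing R] {I : Ideal R} (hI : I ≠ ⊤) :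
    ∃ d : ℕ∞, (d : WithBot ℕ∞) = ringKrullDim (R ⧸ I) := by
  have : Nontrivial (R ⧸ I) := Ideal.Quotient.nontrivial_iff.2 hI
  refine WithBot.ne_bot_iff_exists.1 fun h => ?_
  have := ringKrullDim_nonneg_of_nontrivial (R := R ⧸ I)
  simp [h] at this

theorem quotientDepth_le_ringKrullDim {I : Ideal (CoordRing K n)} (hI : I ≠ ⊤) :
    (quotientDepth I : WithBot ℕ∞) ≤ ringKrullDim (CoordRing K n ⧸ I) := by
  obtain ⟨d, hd⟩ := exists_eq_ringKrullDim_quotient hI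
  rw [← hd, WithBot.coe_le_coe]
  refine sSup_le ?_
  rintro _ ⟨rs, -, h, rfl⟩
  have := length_le_supportDim_of_isRegular rs h
  rw [Module.supportDim_quotient_eq_ringKrullDim, ← hd] at this
  exact_mod_cast this

/-- The depth is at least `n + 1 - c`. So for `c < i ≤ n + 1` some regular sequence is longer than
`n + 1 - i`, and it pushes `Ext^i` beyond degree `n + 1`. -/
theorem IsCohenMacaulayQuotient.subsingleton_ext {I : Ideal (CoordRing K n)}
    (hI : IsCohenMacaulayQuotient I) {c : ℕ} (hc : I.height = c) {i : ℕ} (hi : c < i) :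
    Subsingleton (Ext (ModuleCat.of (CoordRing K n) (CoordRing K n ⧸ I)) (residue K n) i) := by
  by_cases hcn : n + 1 < i
  · exact subsingleton_ext_of_lt _ _ hcn
  have hne : I ≠ ⊤ := by
    rintro rfl
    simp at hc
  have h1 := le_ringKrullDim_quotient_add_height I hne
  rw [← hI, hc] at h1
  have h2 : ((n + 1 : ℕ) : ℕ∞) ≤ quotientDepth I + c := by exact_mod_cast h1
  have h3 : ((n + 1 - i : ℕ) : ℕ∞) < quotientDepth I := by
    by_contra h
    have h4 := h2.trans (add_le_add_left (not_lt.1 h) _)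
    norm_cast at h4
    omega
  obtain ⟨_, ⟨rs, hrs, hreg, rfl⟩, hlt⟩ := lt_sSup_iff.1 h3
  have hlt' : n + 1 - i < rs.length := by exact_mod_cast hlt
  refine subsingleton_ext_of_isWeaklyRegular rs (fun r hr => ?_) hreg.toIsWeaklyRegular i
    (subsingleton_ext_of_lt _ _ (by omega))
  rw [Ideal.annihilator_quotient]
  exact hrs r hr

theorem exists_isRegular_of_subsingleton_ext {I : Ideal (CoordRing K n)}
    (hI : I ≤ idealOfVars (Fin (n + 1)) K) {c : ℕ} (hc : c ≤ n + 1)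
    (h : ∀ i, c < i → Subsingleton
      (Ext (ModuleCat.of (CoordRing K n) (CoordRing K n ⧸ I)) (residue K n) i)) :
    ∃ rs : List (CoordRing K n), (∀ r ∈ rs, r ∈ idealOfVars (Fin (n + 1)) K) ∧
      IsRegular (CoordRing K n ⧸ I) rs ∧ rs.length = n + 1 - c := by
  obtain ⟨rs, h1, h2, h3⟩ := exists_isWeaklyRegular_of_subsingleton_ext
    (m := idealOfVars (Fin (n + 1)) K) not_subsingleton_ext_residue
    (fun M => subsingleton_ext_of_lt M (residue K n) (Nat.lt_succ_self _)) (n + 1 - c) (by omega)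
    (ModuleCat.of (CoordRing K n) (CoordRing K n ⧸ I)) (fun i _ hi => h i (by omega))
  refine ⟨rs, h1, ⟨h2, fun htop => ?_⟩, h3⟩
  -- If the sequence generated all of `R/I`, the surjection onto the nonzero module `R/𝔪` would
  -- vanish.
  let φ : (CoordRing K n ⧸ I) →ₗ[CoordRing K n]
      (CoordRing K n ⧸ idealOfVars (Fin (n + 1)) K) := Submodule.factor hI
  have h4 : (⊤ : Submodule (CoordRing K n) (CoordRing K n ⧸ I)) ≤ LinearMap.ker φ := by
    rw [htop, Submodule.smul_le]
    intro r hr x _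
    rw [LinearMap.mem_ker, map_smul]
    refine Module.mem_annihilator.1 ?_ _
    rw [Ideal.annihilator_quotient]
    exact Ideal.span_le.2 h1 hr
  have h5 : φ (Submodule.mkQ I 1) = 0 := h4 trivial
  exact one_ne_zero (α := CoordRing K n ⧸ idealOfVars (Fin (n + 1)) K) h5

/-- The vanishing gives `n + 1 - c ≤ depth ≤ dim ≤ n + 1 - height ≤ n + 1 - c`, so equality holds
throughout. Only a lower bound on the height is assumed; that it is attained is what later excludes
type zero. -/
theorem isCohenMacaulayQuotient_of_subsingleton_ext {I : Ideal (CoordRing K n)}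
    (hI : I ≤ idealOfVars (Fin (n + 1)) K) {c : ℕ} (hc : (c : ℕ∞) ≤ I.height)
    (h : ∀ i, c < i → Subsingleton
      (Ext (ModuleCat.of (CoordRing K n) (CoordRing K n ⧸ I)) (residue K n) i)) :
    I.height = c ∧ IsCohenMacaulayQuotient I ∧ c ≤ n + 1 := by
  have hne : I ≠ ⊤ := fun h => (inferInstance : (idealOfVars (Fin (n + 1)) K).IsMaximal).ne_top
    (top_le_iff.1 (h ▸ hI))
  have hcn : c ≤ n + 1 := by
    have := hc.trans (Ideal.height_mono hI)
    rw [height_eq_of_isMaximal] at this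
    exact_mod_cast this
  obtain ⟨rs, h1, h2, h3⟩ := exists_isRegular_of_subsingleton_ext hI hcn h
  have h4 : ((n + 1 - c : ℕ) : ℕ∞) ≤ quotientDepth I := le_sSup ⟨rs, h1, h2, by rw [h3]⟩
  have h5 := quotientDepth_le_ringKrullDim hne
  have h6 := ringKrullDim_quotient_add_height_le I hne
  obtain ⟨d, hd⟩ := exists_eq_ringKrullDim_quotient hne
  rw [IsCohenMacaulayQuotient]
  rw [← hd] at h5 h6 ⊢
  generalize I.height = t at *
  generalize quotientDepth I = q at *
  have h5' : q ≤ d := by exact_mod_cast h5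
  have h6' : d + t ≤ ((n + 1 : ℕ) : ℕ∞) := by exact_mod_cast h6
  have hd' : d ≠ ⊤ := by
    rintro rfl
    simp at h6'
  have ht' : t ≠ ⊤ := by
    rintro rfl
    simp at h6'
  have hq' : q ≠ ⊤ := ne_top_of_le_ne_top hd' h5'
  lift d to ℕ using hd'
  lift t to ℕ using ht'
  lift q to ℕ using hq'
  norm_cast at *
  omega

theorem ne_top_of_height_eq {R : Type*} [CommRing R] {I : Ideal R} {c : ℕ} (h : I.height = c) :
    I ≠ ⊤ := by
  rintro rfl
  simp at h

theorem height_inf {R : Type*} [CommRing R] {I J : Ideal R} {c : ℕ} (hI : I.height = c)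
    (hJ : J.height = c) : (I ⊓ J).height = c := by
  refine le_antisymm ((Ideal.height_mono inf_le_left).trans hI.le) ?_
  rw [Ideal.height_eq_inf_minimalPrimes]
  refine le_iInf₂ fun p hp => ?_
  rcases hp.1.1.inf_le.1 hp.1.2 with h | h
  · exact hI.ge.trans (Ideal.height_mono h)
  · exact hJ.ge.trans (Ideal.height_mono h)

/-- The sum of two ideals of height `c` without common minimal primes has height at least
`c + 1`. -/
theorem le_height_sup {R : Type*} [CommRing R] [IsNoetherianRing R] {I J : Ideal R} {c : ℕ}
    (hI : I.height = c) (hJ : J.height = c) (h : Disjoint I.minimalPrimes J.minimalPrimes) :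
    ((c + 1 : ℕ) : ℕ∞) ≤ (I ⊔ J).height := by
  rw [Ideal.height_eq_inf_minimalPrimes]
  refine le_iInf₂ fun p hp => ?_
  by_contra hlt
  have := hp.1.1
  have hpc : p.height ≤ c := by
    rw [not_le, Nat.cast_add, Nat.cast_one] at hlt
    exact Order.le_of_lt_add_one hlt
  -- A prime of height at most `c` over `I ⊔ J` would be minimal over both ideals.
  exact Set.disjoint_left.1 h
    (Ideal.mem_minimalPrimes_of_height_le (le_sup_left.trans hp.1.2) (hpc.trans hI.ge))
    (Ideal.mem_minimalPrimes_of_height_le (le_sup_right.trans hp.1.2) (hpc.trans hJ.ge))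

/-- The Mayer–Vietoris sequence: the diagonal map followed by the difference. -/
theorem exists_exact_prod_quotient {R : Type*} [CommRing R] (I J : Ideal R) :
    ∃ (f : (R ⧸ I ⊓ J) →ₗ[R] (R ⧸ I) × (R ⧸ J)) (g : (R ⧸ I) × (R ⧸ J) →ₗ[R] (R ⧸ I ⊔ J)),
      Function.Exact f g ∧ Function.Injective f ∧ Function.Surjective g := by
  let f : (R ⧸ I ⊓ J) →ₗ[R] (R ⧸ I) × (R ⧸ J) :=
    (Submodule.factor inf_le_left).prod (Submodule.factor inf_le_right)
  let g : (R ⧸ I) × (R ⧸ J) →ₗ[R] (R ⧸ I ⊔ J) :=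
    (Submodule.factor le_sup_left).coprod (-(Submodule.factor le_sup_right))
  have hf : Function.Injective f := by
    rw [← LinearMap.ker_eq_bot, LinearMap.ker_eq_bot']
    intro x hx
    obtain ⟨a, rfl⟩ := Submodule.mkQ_surjective _ x
    have h1 := congrArg Prod.fst hx
    have h2 := congrArg Prod.snd hx
    exact (Submodule.Quotient.mk_eq_zero _).2
      ⟨(Submodule.Quotient.mk_eq_zero _).1 h1, (Submodule.Quotient.mk_eq_zero _).1 h2⟩
  have hg : Function.Surjective g := fun x => by
    obtain ⟨a, rfl⟩ := Submodule.mkQ_surjective _ x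
    exact ⟨(Submodule.mkQ _ a, 0), by simp [g]⟩
  have hfg : Function.Exact f g := by
    rintro ⟨x, y⟩
    obtain ⟨a, rfl⟩ := Submodule.mkQ_surjective _ x
    obtain ⟨b, rfl⟩ := Submodule.mkQ_surjective _ y
    have hgab : g (I.mkQ a, J.mkQ b) = (I ⊔ J).mkQ (a - b) := by
      simp [g, sub_eq_add_neg]
    rw [hgab]
    constructor
    · intro h
      obtain ⟨i, hi, j, hj, hij⟩ := Submodule.mem_sup.1 ((Submodule.Quotient.mk_eq_zero _).1 h)
      refine ⟨(I ⊓ J).mkQ (a - i), Prod.ext ?_ ?_⟩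
      · refine (Submodule.Quotient.eq _).2 ?_
        change a - i - a ∈ I
        rw [sub_sub_cancel_left]
        exact neg_mem hi
      · refine (Submodule.Quotient.eq _).2 ?_
        change a - i - b ∈ J
        rw [show a - i - b = j by rw [sub_right_comm, ← hij, add_sub_cancel_left]]
        exact hj
    · rintro ⟨z, hz⟩
      obtain ⟨e, rfl⟩ := Submodule.mkQ_surjective _ z
      have h1 := (Submodule.Quotient.eq _).1 (congrArg Prod.fst hz)
      have h2 := (Submodule.Quotient.eq _).1 (congrArg Prod.snd hz)
      refine (Submodule.Quotient.mk_eq_zero _).2 ?_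
      rw [show a - b = -(e - a) + (e - b) by ring]
      exact Submodule.add_mem_sup (neg_mem h1) h2
  exact ⟨f, g, hfg, hf, hg⟩

theorem subsingleton_ext_prod {R : Type u} [CommRing R] {M M' : Type u} [AddCommGroup M]
    [Module R M] [AddCommGroup M'] [Module R M'] {N : ModuleCat.{u} R} {i : ℕ}
    (h : Subsingleton (Ext (ModuleCat.of R M) N i))
    (h' : Subsingleton (Ext (ModuleCat.of R M') N i)) :
    Subsingleton (Ext (ModuleCat.of R (M × M')) N i) := by
  let S : ShortComplex (ModuleCat.{u} R) := ModuleCat.shortComplexOfCompEqZero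
    (LinearMap.inl R M M') (LinearMap.snd R M M') (LinearMap.snd_comp_inl R M M')
  have hS : S.ShortExact := ModuleCat.shortComplex_shortExact _ .inl_snd
    LinearMap.inl_injective LinearMap.snd_surjective
  exact subsingleton_ext_X₂ hS h h'

/-- If `𝔪ᵏ f ⊆ I` then `rᵏ f ∈ I`, and `rᵏ` is again regular on `R/I`. -/
theorem saturation_eq_of_isSMulRegular {I : Ideal (CoordRing K n)} {r : CoordRing K n}
    (hr : r ∈ idealOfVars (Fin (n + 1)) K) (hreg : IsSMulRegular (CoordRing K n ⧸ I) r) :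
    saturation I = I := by
  refine le_antisymm ?_ (le_saturation I)
  rintro f ⟨k, hk⟩
  have h1 := hk (r ^ k) (Ideal.pow_mem_pow hr k)
  have h2 : r ^ k • (Submodule.mkQ I f) = 0 := (Submodule.Quotient.mk_eq_zero I).2 h1
  exact (Submodule.Quotient.mk_eq_zero I).1 ((hreg.pow k).right_eq_zero_of_smul h2)

/-- The sum of geometrically linked Cohen-Macaulay ideals is Gorenstein. -/
theorem isGorensteinIdeal_sup {I J : Ideal (CoordRing K n)} {c : ℕ}
    (hI : IsHomogeneousIdeal I) (hJ : IsHomogeneousIdeal J) (hIc : I.height = c)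
    (hJc : J.height = c) (hICM : IsCohenMacaulayQuotient I) (hJCM : IsCohenMacaulayQuotient J)
    (hIJ : Disjoint I.minimalPrimes J.minimalPrimes) (hG : HasCohenMacaulayType (I ⊓ J) 1) :
    IsGorensteinIdeal (I ⊔ J) ∧ (I ⊔ J).height = ((c + 1 : ℕ) : ℕ∞) ∧
      (c < n → saturation (I ⊔ J) = I ⊔ J) := by
  obtain ⟨F, c', hc', hF, hFc⟩ := hG
  obtain rfl : c = c' := by
    rw [height_inf hIc hJc] at hc'
    exact_mod_cast hc'
  have hsup : IsHomogeneousIdeal (I ⊔ J) := Ideal.IsHomogeneous.sup hI hJ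
  have hle : I ⊔ J ≤ idealOfVars (Fin (n + 1)) K :=
    sup_le (hI.le_idealOfVars (ne_top_of_height_eq hIc))
      (hJ.le_idealOfVars (ne_top_of_height_eq hJc))
  have hheight := le_height_sup hIc hJc hIJ
  obtain ⟨G⟩ := exists_minimalFreeResolution hsup hle
  have hprod : ∀ i, c < i → Subsingleton (Ext (ModuleCat.of (CoordRing K n)
      ((CoordRing K n ⧸ I) × (CoordRing K n ⧸ J))) (residue K n) i) := fun i hi =>
    subsingleton_ext_prod (hICM.subsingleton_ext hIc hi) (hJCM.subsingleton_ext hJc hi)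
  obtain ⟨f, g, hfg, hf, hg⟩ := exists_exact_prod_quotient I J
  have hS : (ModuleCat.shortComplexOfCompEqZero f g hfg.linearMap_comp_eq_zero).ShortExact :=
    ModuleCat.shortComplex_shortExact _ hfg hf hg
  have hext : ∀ i, c + 1 < i → Subsingleton
      (Ext (ModuleCat.of (CoordRing K n) (CoordRing K n ⧸ I ⊔ J)) (residue K n) i) := by
    rintro (_ | i) hi
    · omega
    · exact subsingleton_ext_X₃ hS ((F.subsingleton_ext_iff i).2 (hF i (by omega)))
        (hprod (i + 1) (by omega))
  obtain ⟨hht, hCM, hcn⟩ := isCohenMacaulayQuotient_of_subsingleton_ext hle hheight hext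
  -- `Ext^(c+1)` of the middle term vanishes, so the connecting map from `Ext^c(R/(I ∩ J), k)` is
  -- onto.
  have hrank_le : G.rank (c + 1) ≤ 1 := by
    refine (F.rank_le_of_surjective G
      (hS.extClass.precompOfLinear (CoordRing K n) (residue K n) (add_comm 1 c)) fun x => ?_).trans
        hFc.le
    exact Ext.contravariant_sequence_exact₃ hS _ x ((hprod (c + 1) (by omega)).elim _ _)
      (add_comm 1 c)
  -- Otherwise Ext would vanish above `c`, forcing the height to be `c` instead of `c + 1`.
  have hrank_ne : G.rank (c + 1) ≠ 0 := by
    intro h0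
    have hext' : ∀ i, c < i → Subsingleton
        (Ext (ModuleCat.of (CoordRing K n) (CoordRing K n ⧸ I ⊔ J)) (residue K n) i) := by
      intro i hi
      obtain rfl | h := (Nat.succ_le_of_lt hi).eq_or_lt
      · exact (G.subsingleton_ext_iff _).2 h0
      · exact hext i h
    have := (isCohenMacaulayQuotient_of_subsingleton_ext hle
      (le_trans (by exact_mod_cast Nat.le_succ c) hheight) hext').1
    rw [hht] at this
    norm_cast at this
    omega
  refine ⟨⟨hsup, hCM, G, c + 1, hht, fun i hi => (G.subsingleton_ext_iff i).1 (hext i hi),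
    by omega⟩, hht, fun hlt => ?_⟩
  -- The sequence has length `n + 1 - (c + 1) > 0`, and its first element proves saturation.
  obtain ⟨rs, hrs, hreg, hlen⟩ := exists_isRegular_of_subsingleton_ext hle hcn hext
  obtain _ | ⟨r, rs⟩ := rs
  · rw [List.length_nil] at hlen
    omega
  · exact saturation_eq_of_isSMulRegular (hrs r (by simp))
      ((isRegular_cons_iff _ _ _).1 hreg).1

end Gorenstein

end Liaison

theorem mainTheorem11 {K : Type*} [Field K] (n c : ℕ) (V₁ V₂ : Liaison.ProjSubscheme K n)
    (hV₁ : V₁.IsACM) (hV₂ : V₂.IsACM) (hc₁ : V₁.HasCodim c) (hc₂ : V₂.HasCodim c)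
    (hV : V₁.NoCommonComponent V₂) (hX : (V₁.union V₂).IsArithmeticallyGorenstein) :
    Liaison.IsGorensteinIdeal (V₁.ideal ⊔ V₂.ideal) ∧
      (V₁.ideal ⊔ V₂.ideal).height = ((c + 1 : ℕ) : ℕ∞) ∧
      (c < n → (V₁.inter V₂).ideal = V₁.ideal ⊔ V₂.ideal ∧
        (V₁.inter V₂).IsArithmeticallyGorenstein) := by
  obtain ⟨hG, hht, hsat⟩ := Liaison.isGorensteinIdeal_sup V₁.isHomogeneous V₂.isHomogeneous
    hc₁ hc₂ hV₁ hV₂ hV hX.2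
  refine ⟨hG, hht, fun hlt => ?_⟩
  have h : (V₁.inter V₂).ideal = V₁.ideal ⊔ V₂.ideal := hsat hlt
  rw [Liaison.ProjSubscheme.IsArithmeticallyGorenstein, Liaison.ProjSubscheme.IsACM, h]
  exact ⟨rfl, hG.2⟩
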